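/- Fix an integer $n\ge 2$ and reals $\lambda_e,\lambda>0$, $B\ge 0$. Consider a fully connected network of $n$ nodes and a source. The source generates new versions according to a Poisson process of rate $\lambda_e$ and sends its current version to each node according to a Poisson process of rate $\lambda/n$; these $n+1$ Poisson processes are independent, with increments independent of the past history $\mathcal F_s$. A (symmetric) gossip policy assigns to each node $j$ a total gossip rate $r_j(t)\ge 0$, a progressively measurable process with respect to the history $(\mathcal F_t)$ (which may contain extra randomization), and node $j$ splits this rate equally over its $n-1$ neighbours: $j$ sends its version to $i\ne j$ at the events of a counting process with stochastic intensity $r_j(t)/(n-1)$. Almost surely no two events are simultaneous. A node receiving a version from another node keeps the fresher of the two. The version age $\Delta_i(t)$ of node $i$ is the source's version number minus that of node $i$; initially the ages are nonnegative with finite mean. The steady-state mean age of node $i$ is $a_i=\lim_{t\to\infty}\mathbb E[\Delta_i(t)]$ when this limit exists. Put $$a^*=\frac{\lambda_e+\frac{B}{n-1}\frac{\lambda_e}{\lambda}}{\frac{\lambda}{n}+\frac{B}{n-1}} .$$ (1) Under any such policy with $\sum_j r_j(t)\le B$ for all $t$, all ages have finite mean and, for every node $i$, $\liminf_{t\to\infty}\mathbb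 E[\Delta_i(t)]\ge a^*$; in particular $a_i\ge a^*$ whenever the steady-state mean age exists. (2) The semi-distributed scheme, in which a node gossips at the full rate $B$ from the moment it receives a transmission from the source until the source transmits to another node (and no other node gossips), satisfies $\sum_j r_j(t)\le B$, and under it $\lim_{t\to\infty}\mathbb E[\Delta_i(t)]=a^*$ for every node $i$. (3) Hence the steady-state mean age of a node under the semi-distributed scheme is at most the steady-state mean age of a node under any policy with $\sum_j r_j(t)\le B$ for which the latter exists. -/

import Mathlib

open MeasureTheory ProbabilityTheory Filter
open scoped NNReal Topology

/-- The events that can happen in a network of `n` nodes served by one source. -/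
inductive GossipEvent (n : ℕ) : Type
  /-- the source generates a new version -/
  | refresh : GossipEvent n
  /-- the source sends its current version to node `i` -/
  | deliver (i : Fin n) : GossipEvent n
  /-- node `j` sends its version to node `i` -/
  | gossip (j i : Fin n) : GossipEvent n

/-- The version numbers held by the source and by the nodes. -/
structure Versions (n : ℕ) where
  source : ℕ
  node : Fin n → ℕ

/-- The effect of an event on the versions; on a gossip the receiver keeps the fresher version. -/
def Versions.step {n : ℕ} (x : Versions n) : GossipEvent n → Versions n
  | .refresh => ⟨x.source + 1, x.node⟩
  | .deliver i => ⟨x.source, Function.update x.node i x.source⟩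
  | .gossip j i => ⟨x.source, Function.update x.node i (max (x.node j) (x.node i))⟩

/-- The version age of node `i`. -/
def Versions.age {n : ℕ} (x : Versions n) (i : Fin n) : ℝ :=
  (x.source : ℝ) - (x.node i : ℝ)

/-- No event happens in `(s, t]`, for an assignment `c` of counting paths to the events. -/
def NoEvent {n : ℕ} (c : GossipEvent n → ℝ≥0 → ℕ) (s t : ℝ≥0) : Prop :=
  ∀ e, c e t = c e s

/-- Exactly one event happens in `(s, t]`, and it is `e`. -/
def OnlyEvent {n : ℕ} (c : GossipEvent n → ℝ≥0 → ℕ) (e : GossipEvent n) (s t : ℝ≥0) : Prop :=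
  c e t = c e s + 1 ∧ ∀ e', e' ≠ e → c e' t = c e' s

/-- The two kinds of events driven by the source: `none` is a new version at the source, `some i`
is a transmission from the source to node `i`. -/
def sourceEvent {n : ℕ} : Option (Fin n) → GossipEvent n
  | none => .refresh
  | some i => .deliver i

/-- The rates of the events driven by the source: new versions appear at rate `lamE`, and the total
transmission rate `lam` is shared equally by the `n` nodes. -/
noncomputable def sourceRate {n : ℕ} (lamE lam : ℝ≥0) : Option (Fin n) → ℝ≥0
  | none => lamE
  | some _ => lam / n

/-- A symmetric fully connected gossip network of `n` nodes run under an arbitrary gossip policy.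

The policy is the family `rate j t ω`, the total gossip rate given to node `j` at time `t`. It may
depend on the whole history `ℱ t` (which may also hold additional randomization), and node `j`
spreads this rate equally over its `n - 1` neighbours. -/
structure GossipNetwork {Ω : Type*} [mΩ : MeasurableSpace Ω] (P : Measure Ω)
    (n : ℕ) (lamE lam : ℝ≥0) where
  /-- the history -/
  ℱ : Filtration ℝ≥0 mΩ
  /-- the number of occurrences of each event in `(0, t]` -/
  count : GossipEvent n → ℝ≥0 → Ω → ℕ
  /-- the versions held at time `t` -/
  state : ℝ≥0 → Ω → Versions n
  /-- the gossip rate of each node -/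
  rate : Fin n → ℝ≥0 → Ω → ℝ
  -- counting processes: adapted, starting at `0`, nondecreasing and right-continuous
  count_adapted : ∀ e, Adapted ℱ (count e)
  count_zero : ∀ e ω, count e 0 ω = 0
  count_mono : ∀ e ω, Monotone fun t => count e t ω
  count_right : ∀ e ω t, ∀ᶠ s in 𝓝[>] t, count e s ω = count e t ω
  -- almost surely at most one event happens at each time
  no_simultaneous : ∀ᵐ ω ∂P, ∀ t : ℝ≥0, 0 < t → ∃ s < t,
    NoEvent (fun e r => count e r ω) s t ∨ ∃ e, OnlyEvent (fun e r => count e r ω) e s t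
  -- the source drives independent Poisson processes
  source_law : ∀ (o : Option (Fin n)) (s t : ℝ≥0), s ≤ t →
    HasLaw (fun ω => count (sourceEvent o) t ω - count (sourceEvent o) s ω)
      (poissonMeasure (sourceRate lamE lam o * (t - s))) P
  source_iIndep : ∀ s t : ℝ≥0, s ≤ t →
    iIndepFun (fun (o : Option (Fin n)) ω =>
      count (sourceEvent o) t ω - count (sourceEvent o) s ω) P
  source_indep_past : ∀ s t : ℝ≥0, s ≤ t →
    Indep (MeasurableSpace.comap (fun ω (o : Option (Fin n)) =>
      count (sourceEvent o) t ω - count (sourceEvent o) s ω) inferInstance) (ℱ s) P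
  -- the gossip policy, and the gossip events `j → i` with stochastic intensity `rate j / (n - 1)`
  rate_progressive : ∀ j, IsStronglyProgressive ℱ (rate j)
  rate_nonneg : ∀ j t ω, 0 ≤ rate j t ω
  gossip_intensity : ∀ j i, Martingale (fun t ω => (count (.gossip j i) t ω : ℝ) -
    ∫ s in (0 : ℝ)..t, if j = i then 0 else rate j s.toNNReal ω / ((n : ℝ) - 1)) ℱ P
  -- the evolution of the versions
  state_adapted : ∀ t, Measurable[ℱ t] (fun ω => (state t ω).source) ∧
    ∀ i, Measurable[ℱ t] (fun ω => (state t ω).node i)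
  state_const : ∀ ω s t, s ≤ t → NoEvent (fun e r => count e r ω) s t → state t ω = state s ω
  state_step : ∀ ω s t e, s ≤ t → OnlyEvent (fun e r => count e r ω) e s t →
    state t ω = (state s ω).step e
  -- initially no node is ahead of the source, and the ages have finite mean
  init_le : ∀ ω i, (state 0 ω).node i ≤ (state 0 ω).source
  init_integrable : ∀ i, Integrable (fun ω => (state 0 ω).age i) P

namespace GossipNetwork

variable {Ω : Type*} [MeasurableSpace Ω] {P : Measure Ω} {n : ℕ} {lamE lam : ℝ≥0}

/-- The version age of node `i` at time `t`. -/
def age (G : GossipNetwork P n lamE lam) (i : Fin n) (t : ℝ≥0) (ω : Ω) : ℝ :=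
  (G.state t ω).age i

/-- The mean version age of node `i` at time `t`. -/
noncomputable def meanAge (G : GossipNetwork P n lamE lam) (i : Fin n) (t : ℝ≥0) : ℝ :=
  ∫ ω, G.age i t ω ∂P

/-- `a` is the steady-state mean age of node `i`. -/
def HasSteadyStateMeanAge (G : GossipNetwork P n lamE lam) (i : Fin n) (a : ℝ) : Prop :=
  Tendsto (G.meanAge i) atTop (𝓝 a)

/-- The total instantaneous gossip rate never exceeds `B`. -/
def TotalRateLE (G : GossipNetwork P n lamE lam) (B : ℝ) : Prop :=
  ∀ t ω, ∑ j, G.rate j t ω ≤ B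

/-- Node `i` is, at time `t`, the last node that received a transmission from the source: for some
`s < t`, in `(s, t]` the source has sent to `i` and to no other node. -/
def IsLastUpdated (G : GossipNetwork P n lamE lam) (i : Fin n) (t : ℝ≥0) (ω : Ω) : Prop :=
  ∃ s < t, G.count (.deliver i) s ω < G.count (.deliver i) t ω ∧
    ∀ k, k ≠ i → G.count (.deliver k) t ω = G.count (.deliver k) s ω

open scoped Classical in
/-- The semi-distributed scheme: a node gossips at the full rate `B` from the moment it receives a
transmission from the source until the source transmits to another node. -/
def IsSemiDistributed (G : GossipNetwork P n lamE lam) (B : ℝ) : Prop :=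
  ∀ j t ω, G.rate j t ω = if G.IsLastUpdated j t ω then B else 0

end GossipNetwork

/-- The optimal steady-state mean age. -/
noncomputable def optimalAge (n : ℕ) (lamE lam B : ℝ) : ℝ :=
  (lamE + B / ((n : ℝ) - 1) * (lamE / lam)) / (lam / n + B / ((n : ℝ) - 1))

/-! Let m(t) be the mean of the smallest age, a(t) the mean age of node i, and β = B/(n-1). Gossip
copies versions but never creates a fresher one. So under every policy the smallest age grows by one
at a refresh and drops to zero at any transmission of the source: m' = lamE - lam m, and m tends to
lamE/lam (`tendsto_meanMinAge`). A gossip reaching i lowers its age by at most the excess of that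
age over the smallest one, and the gossips reaching i have total intensity at most β. Hence a' ≥
lamE - (lam/n) a - β (a - m), which keeps a asymptotically above (lamE + β lamE/lam)/(lam/n + β),
that is `optimalAge`. In the semi-distributed scheme the only gossiping node is the one last served
by the source; it holds the freshest version, so the inequality becomes an equality, up to an error
from the time before the first transmission, which decays exponentially.

No derivative is taken, as a policy is only progressively measurable. Instead the mean change over
(t, t+h] is computed to first order given the past, and the error is governed by the expected number
of events beyond the first, which is O(h²) uniformly over policies
(`lintegral_mul_totalInc_sub_one_le`). For each fixed h this is a recursion that settles within O(h)
of the equilibrium of the differential equation, and h is arbitrary (`eventually_ge_of_recursion`,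
`eventually_le_of_recursion`). -/

open scoped ENNReal

/-! ### Counting paths: meshes with at most one event per cell, and induction along a path. -/

section Paths

variable {n : ℕ}

/-- An enumeration of the events: those driven by the source, and the gossip transmissions. -/
def eventOf : Option (Fin n) ⊕ (Fin n × Fin n) → GossipEvent n
  | .inl o => sourceEvent o
  | .inr p => .gossip p.1 p.2

/-- Sums over events are taken through this bijection: the index type is a `Fintype` that splits
into source events and gossips, whose rates are treated differently. -/
theorem eventOf_bijective : Function.Bijective (eventOf (n := n)) := by
  constructor
  · rintro ((_ | i) | ⟨j, i⟩) ((_ | i') | ⟨j', i'⟩) h <;>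
      simp_all [eventOf, sourceEvent]
  · rintro (_ | i | ⟨j, i⟩)
    · exact ⟨.inl none, rfl⟩
    · exact ⟨.inl (some i), rfl⟩
    · exact ⟨.inr (j, i), rfl⟩

instance : Finite (GossipEvent n) := Finite.of_surjective _ eventOf_bijective.2

/-- At most one event happens in `(s, t]`. -/
def AtMostOneEvent (c : GossipEvent n → ℝ≥0 → ℕ) (s t : ℝ≥0) : Prop :=
  NoEvent c s t ∨ ∃ e, OnlyEvent c e s t

variable {c : GossipEvent n → ℝ≥0 → ℕ}

theorem AtMostOneEvent.mono (hm : ∀ e, Monotone (c e)) {s a b r : ℝ≥0} (hsa : s ≤ a) (hab : a ≤ b)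
    (hbr : b ≤ r) (h : AtMostOneEvent c s r) : AtMostOneEvent c a b := by
  have key : ∀ e, c e s ≤ c e a ∧ c e a ≤ c e b ∧ c e b ≤ c e r :=
    fun e => ⟨hm e hsa, hm e hab, hm e hbr⟩
  rcases h with h | ⟨e, h1, h2⟩
  · left; intro e; have := h e; have := key e; omega
  · by_cases hc : c e b = c e a
    · left; intro e'
      by_cases he : e' = e
      · rw [he, hc]
      · have := h2 e' he; have := key e'; omega
    · right; refine ⟨e, ?_, fun e' he => ?_⟩
      · have := key e; omega
      · have := h2 e' he; have := key e'; omega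

theorem AtMostOneEvent.trans_noEvent {s t r : ℝ≥0} (h : AtMostOneEvent c s t)
    (h' : NoEvent c t r) : AtMostOneEvent c s r := by
  rcases h with h | ⟨e, h1, h2⟩
  · exact .inl fun e => (h' e).trans (h e)
  · exact .inr ⟨e, (h' e).trans h1, fun e' he => (h' e').trans (h2 e' he)⟩

theorem AtMostOneEvent.sum_le_one {a b : ℝ≥0} (h : AtMostOneEvent c a b) :
    ∑ x, (c (eventOf x) b - c (eventOf x) a) ≤ 1 := by
  rcases h with h | ⟨e, h1, h2⟩
  · simp [h _]
  · obtain ⟨y, rfl⟩ := eventOf_bijective.2 e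
    rw [Finset.sum_eq_single y]
    · omega
    · intro z _ hz
      rw [h2 _ fun hh => hz (eventOf_bijective.1 hh)]; simp
    · simp

theorem noEvent_of_sum_eq_zero (hm : ∀ e, Monotone (c e)) {a b : ℝ≥0} (hab : a ≤ b)
    (h : ∑ x, (c (eventOf x) b - c (eventOf x) a) = 0) : NoEvent c a b := by
  intro e
  obtain ⟨y, rfl⟩ := eventOf_bijective.2 e
  have := (Finset.sum_eq_zero_iff.1 h) y (Finset.mem_univ _)
  have := hm (eventOf y) hab
  omega

theorem onlyEvent_of_sum_eq_one (hm : ∀ e, Monotone (c e)) {a b : ℝ≥0} (hab : a ≤ b)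
    (h : ∑ x, (c (eventOf x) b - c (eventOf x) a) = 1) : ∃ e, OnlyEvent c e a b := by
  classical
  obtain ⟨y, -, hy⟩ : ∃ y ∈ Finset.univ, c (eventOf y) b - c (eventOf y) a ≠ 0 := by
    apply Finset.exists_ne_zero_of_sum_ne_zero; omega
  have hs := Finset.add_sum_erase Finset.univ (fun x => c (eventOf x) b - c (eventOf x) a)
    (Finset.mem_univ y)
  have h0 : ∑ x ∈ Finset.univ.erase y, (c (eventOf x) b - c (eventOf x) a) = 0 := by omega
  refine ⟨eventOf y, by omega, fun e' he => ?_⟩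
  obtain ⟨z, rfl⟩ := eventOf_bijective.2 e'
  have hz : z ≠ y := fun hh => he (by rw [hh])
  have := (Finset.sum_eq_zero_iff.1 h0) z (by simp [hz])
  have := hm (eventOf z) hab
  omega

/-- Short enough intervals hold at most one event. -/
theorem exists_mesh (hm : ∀ e, Monotone (c e))
    (hr : ∀ e t, ∀ᶠ s in 𝓝[>] t, c e s = c e t)
    (hl : ∀ t : ℝ≥0, 0 < t → ∃ s < t, AtMostOneEvent c s t) (T : ℝ≥0) :
    ∃ δ > (0 : ℝ), ∀ a b : ℝ≥0, a ≤ b → b ≤ T → (b : ℝ) - a < δ → AtMostOneEvent c a b := by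
  -- Around t, right-continuity of the finitely many counts gives an eventless interval after t, and
  -- `hl` an interval before t with at most one event; at t = 0 nothing precedes. A Lebesgue number
  -- of this cover of [0, T] is the mesh.
  have loc : ∀ t : ℝ≥0, ∃ U : Set ℝ≥0, IsOpen U ∧ t ∈ U ∧
      ∀ a ∈ U, ∀ b ∈ U, a ≤ b → AtMostOneEvent c a b := by
    intro t
    obtain ⟨r, hrt, htr⟩ : ∃ r, NoEvent c t r ∧ t < r :=
      ((eventually_all.2 fun e => hr e t).and self_mem_nhdsWithin).exists
    rcases eq_or_lt_of_le (zero_le : 0 ≤ t) with h0 | h0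
    · refine ⟨Set.Iio r, isOpen_Iio, htr, fun a _ b hb hab => ?_⟩
      exact AtMostOneEvent.mono hm (h0 ▸ zero_le) hab (le_of_lt hb) (.inl hrt)
    · obtain ⟨s, hst, hs⟩ := hl t h0
      refine ⟨Set.Ioo s r, isOpen_Ioo, ⟨hst, htr⟩, fun a ha b hb hab => ?_⟩
      exact (hs.trans_noEvent hrt).mono hm ha.1.le hab hb.2.le
  choose U hU htU hUc using loc
  obtain ⟨δ, hδ, h⟩ := lebesgue_number_lemma_of_metric (isCompact_Icc (a := (0 : ℝ≥0)) (b := T)) hU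
    (fun x _ => Set.mem_iUnion.2 ⟨x, htU x⟩)
  refine ⟨δ, hδ, fun a b hab hbT hd => ?_⟩
  obtain ⟨i, hi⟩ := h a ⟨zero_le, hab.trans hbT⟩
  refine hUc i a (hi (Metric.mem_ball_self hδ)) b (hi ?_) hab
  rw [Metric.mem_ball, NNReal.dist_eq, abs_of_nonneg (sub_nonneg.2 (NNReal.coe_le_coe.2 hab))]
  exact hd

/-- The points of the division of `(s, s + h]` into `m + 1` cells. -/
noncomputable def meshPoint (s h : ℝ≥0) (m k : ℕ) : ℝ≥0 := s + k * (h / (m + 1))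

theorem meshPoint_zero (s h : ℝ≥0) (m : ℕ) : meshPoint s h m 0 = s := by simp [meshPoint]

theorem meshPoint_last (s h : ℝ≥0) (m : ℕ) : meshPoint s h m (m + 1) = s + h := by
  have : (m : ℝ≥0) + 1 ≠ 0 := by positivity
  simp only [meshPoint]; push_cast; field_simp

theorem meshPoint_mono (s h : ℝ≥0) (m : ℕ) : Monotone (meshPoint s h m) := by
  intro a b hab
  unfold meshPoint
  gcongr

theorem meshPoint_succ (s h : ℝ≥0) (m k : ℕ) :
    meshPoint s h m (k + 1) = meshPoint s h m k + h / (m + 1) := by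
  simp only [meshPoint]; push_cast; ring

/-- The admissible mesh depends on the path, hence the statement for all large m instead of one m
for all paths. -/
theorem eventually_mesh (hm : ∀ e, Monotone (c e))
    (hr : ∀ e t, ∀ᶠ s in 𝓝[>] t, c e s = c e t)
    (hl : ∀ t : ℝ≥0, 0 < t → ∃ s < t, AtMostOneEvent c s t) (s h : ℝ≥0) :
    ∀ᶠ m : ℕ in atTop, ∀ k < m + 1,
      AtMostOneEvent c (meshPoint s h m k) (meshPoint s h m (k + 1)) := by
  obtain ⟨δ, hδ, H⟩ := exists_mesh hm hr hl (s + h)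
  have lim : Tendsto (fun m : ℕ => (h : ℝ) / ((m : ℝ) + 1)) atTop (𝓝 0) := by
    have := tendsto_one_div_add_atTop_nhds_zero_nat (𝕜 := ℝ)
    simpa [div_eq_mul_inv] using this.const_mul (h : ℝ)
  filter_upwards [lim.eventually (gt_mem_nhds hδ)] with m hmδ k hk
  refine H _ _ (meshPoint_mono _ _ _ (Nat.le_succ k)) ?_ ?_
  · rw [← meshPoint_last s h m]
    exact meshPoint_mono _ _ _ hk
  · rw [meshPoint_succ]; push_cast; simpa using hmδ

/-- Induction along a path. -/
theorem path_induction (hm : ∀ e, Monotone (c e))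
    (hr : ∀ e t, ∀ᶠ s in 𝓝[>] t, c e s = c e t)
    (hl : ∀ t : ℝ≥0, 0 < t → ∃ s < t, AtMostOneEvent c s t) {Q : ℝ≥0 → Prop} {s t : ℝ≥0}
    (hst : s ≤ t) (h0 : Q s)
    (hstep : ∀ a b, s ≤ a → a < b → AtMostOneEvent c a b → Q a → Q b) : Q t := by
  obtain ⟨h, rfl⟩ := exists_add_of_le hst
  -- The step is available only for `a < b`, a strictness that `IsLastUpdated` requires, so the
  -- empty interval is split off.
  rcases eq_or_lt_of_le (zero_le : 0 ≤ h) with hh | hh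
  · rw [← hh, add_zero]; exact h0
  obtain ⟨m, hmm⟩ := (eventually_mesh hm hr hl s h).exists
  have : ∀ k ≤ m + 1, Q (meshPoint s h m k) := by
    intro k
    induction k with
    | zero => intro _; rw [meshPoint_zero]; exact h0
    | succ k ih =>
      intro hk
      refine hstep _ _ ?_ ?_ (hmm k (by omega)) (ih (by omega))
      · exact le_self_add
      · rw [meshPoint_succ]
        exact lt_add_of_pos_right _ (by positivity)
  rw [← meshPoint_last s h m]
  exact this _ le_rfl

end Paths

/-! ### Pathwise properties of versions and ages. -/

namespace GossipNetwork

variable {Ω : Type*} [MeasurableSpace Ω] {P : Measure Ω} {n : ℕ} {lamE lam : ℝ≥0}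
  (G : GossipNetwork P n lamE lam)

/-- The number of occurrences of `e` in `(s, t]`. -/
def inc (e : GossipEvent n) (s t : ℝ≥0) (ω : Ω) : ℕ := G.count e t ω - G.count e s ω

/-- The number of events in `(s, t]`. -/
def totalInc (s t : ℝ≥0) (ω : Ω) : ℕ := ∑ x, G.inc (eventOf x) s t ω

/-- Along `ω` no two events are simultaneous. -/
def IsRegular (ω : Ω) : Prop :=
  ∀ t : ℝ≥0, 0 < t → ∃ s < t, AtMostOneEvent (fun e r => G.count e r ω) s t

theorem ae_isRegular : ∀ᵐ ω ∂P, G.IsRegular ω := G.no_simultaneous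

/-- The freshest version held by a node. -/
def maxNode (t : ℝ≥0) (ω : Ω) : ℕ := Finset.univ.sup (G.state t ω).node

/-- The smallest version age of a node. -/
def minAge (t : ℝ≥0) (ω : Ω) : ℝ := ((G.state t ω).source : ℝ) - (G.maxNode t ω : ℝ)

variable {G} {ω : Ω}

theorem inc_add {e : GossipEvent n} {s t u : ℝ≥0} (hst : s ≤ t) (htu : t ≤ u) :
    G.inc e s u ω = G.inc e s t ω + G.inc e t u ω := by
  have h1 := G.count_mono e ω hst
  have h2 := G.count_mono e ω htu
  simp only [inc] at *
  omega

theorem totalInc_add {s t u : ℝ≥0} (hst : s ≤ t) (htu : t ≤ u) :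
    G.totalInc s u ω = G.totalInc s t ω + G.totalInc t u ω := by
  simp only [totalInc, ← Finset.sum_add_distrib, inc_add hst htu]

/-- Reduces an invariant to two checks: the state stays put, or takes a single `Versions.step`. -/
theorem IsRegular.induction (hω : G.IsRegular ω) {Q : ℝ≥0 → Prop} {s t : ℝ≥0}
    (hst : s ≤ t) (h0 : Q s)
    (hno : ∀ a b, s ≤ a → a < b → NoEvent (fun e r => G.count e r ω) a b →
      G.state b ω = G.state a ω → Q a → Q b)
    (honly : ∀ a b e, s ≤ a → a < b → OnlyEvent (fun e r => G.count e r ω) e a b →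
      G.state b ω = (G.state a ω).step e → Q a → Q b) : Q t := by
  refine path_induction (c := fun e r => G.count e r ω) (fun e => G.count_mono e ω)
    (fun e => G.count_right e ω) hω hst h0 fun a b hsa hab h hQ => ?_
  rcases h with h | ⟨e, h⟩
  · exact hno a b hsa hab h (G.state_const ω a b hab.le h) hQ
  · exact honly a b e hsa hab h (G.state_step ω a b e hab.le h) hQ

theorem IsRegular.node_le_source (hω : G.IsRegular ω) (t : ℝ≥0) (i : Fin n) :
    (G.state t ω).node i ≤ (G.state t ω).source := by
  suffices ∀ i, (G.state t ω).node i ≤ (G.state t ω).source from this i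
  refine hω.induction (Q := fun t => ∀ i, (G.state t ω).node i ≤ (G.state t ω).source)
    (zero_le : 0 ≤ t) (G.init_le ω) ?_ ?_
  · intro a b _ _ _ h hQ; rw [h]; exact hQ
  · intro a b e _ _ _ h hQ i
    rw [h]
    rcases e with _ | k | ⟨j, k⟩
    · exact (hQ i).trans (Nat.le_succ _)
    · by_cases hik : i = k
      · subst hik; simp [Versions.step]
      · simpa [Versions.step, hik] using hQ i
    · by_cases hik : i = k
      · subst hik; simpa [Versions.step] using ⟨hQ j, hQ i⟩
      · simpa [Versions.step, hik] using hQ i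

/-- A delivery overwrites the version held, so monotonicity rests on no node being ahead of the
source. -/
theorem IsRegular.node_mono (hω : G.IsRegular ω) {s t : ℝ≥0} (hst : s ≤ t) (i : Fin n) :
    (G.state s ω).node i ≤ (G.state t ω).node i := by
  refine hω.induction (Q := fun t => (G.state s ω).node i ≤ (G.state t ω).node i)
    hst le_rfl ?_ ?_
  · intro a b _ _ _ h hQ; rw [h]; exact hQ
  · intro a b e _ _ _ h hQ
    refine hQ.trans ?_
    rw [h]
    rcases e with _ | k | ⟨j, k⟩
    · exact le_rfl
    · by_cases hik : i = k
      · subst hik; simpa [Versions.step] using hω.node_le_source a i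
      · simp [Versions.step, hik]
    · by_cases hik : i = k
      · subst hik; simp [Versions.step]
      · simp [Versions.step, hik]

theorem IsRegular.source_eq (hω : G.IsRegular ω) {s t : ℝ≥0} (hst : s ≤ t) :
    (G.state t ω).source = (G.state s ω).source + G.inc .refresh s t ω := by
  refine hω.induction (Q := fun t => (G.state t ω).source =
    (G.state s ω).source + G.inc .refresh s t ω) hst (by simp [inc]) ?_ ?_
  · intro a b _ _ hno h hQ
    have := hno .refresh
    simp only [inc] at *
    rw [h, hQ, this]
  · intro a b e hsa hab ho h hQ
    rw [inc_add hsa hab.le, h]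
    rcases e with _ | k | ⟨j, k⟩
    · have := ho.1
      simp only [Versions.step, inc] at *; omega
    · have := ho.2 .refresh (by simp)
      simp only [Versions.step, inc] at *; omega
    · have := ho.2 .refresh (by simp)
      simp only [Versions.step, inc] at *; omega

theorem IsRegular.age_nonneg (hω : G.IsRegular ω) (t : ℝ≥0) (i : Fin n) : 0 ≤ G.age i t ω := by
  simpa [age, Versions.age] using hω.node_le_source t i

/-- Receptions only lower an age. This dominates every later age by an integrable variable, whatever
the policy. -/
theorem IsRegular.age_le (hω : G.IsRegular ω) {s t : ℝ≥0} (hst : s ≤ t) (i : Fin n) :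
    G.age i t ω ≤ G.age i s ω + G.inc .refresh s t ω := by
  have h1 : ((G.state s ω).node i : ℝ) ≤ (G.state t ω).node i := by
    exact_mod_cast hω.node_mono hst i
  simp only [age, Versions.age, hω.source_eq hst]
  push_cast
  linarith

theorem IsRegular.maxNode_le_source (hω : G.IsRegular ω) (t : ℝ≥0) :
    G.maxNode t ω ≤ (G.state t ω).source :=
  Finset.sup_le fun i _ => hω.node_le_source t i

theorem IsRegular.minAge_nonneg (hω : G.IsRegular ω) (t : ℝ≥0) : 0 ≤ G.minAge t ω := by
  simpa [minAge] using hω.maxNode_le_source t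

theorem node_le_maxNode (t : ℝ≥0) (i : Fin n) : (G.state t ω).node i ≤ G.maxNode t ω :=
  Finset.le_sup (f := (G.state t ω).node) (Finset.mem_univ i)

theorem minAge_le_age (t : ℝ≥0) (i : Fin n) : G.minAge t ω ≤ G.age i t ω := by
  have : ((G.state t ω).node i : ℝ) ≤ G.maxNode t ω := by
    exact_mod_cast node_le_maxNode (G := G) (ω := ω) t i
  simp only [minAge, age, Versions.age]; linarith

theorem IsRegular.minAge_le (hω : G.IsRegular ω) {s t : ℝ≥0} (hst : s ≤ t) :
    G.minAge t ω ≤ G.minAge s ω + G.inc .refresh s t ω := by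
  have h1 : (G.maxNode s ω : ℝ) ≤ G.maxNode t ω := by
    exact_mod_cast Finset.sup_mono_fun fun i _ => hω.node_mono hst i
  simp only [minAge, hω.source_eq hst]
  push_cast
  linarith

theorem IsLastUpdated.persist {j : Fin n} {t u : ℝ≥0} (htu : t ≤ u)
    (h : G.IsLastUpdated j t ω)
    (hd : ∀ k, G.count (.deliver k) u ω = G.count (.deliver k) t ω) : G.IsLastUpdated j u ω := by
  obtain ⟨s, hs, h1, h2⟩ := h
  exact ⟨s, hs.trans_le htu, by rw [hd]; exact h1, fun k hk => by rw [hd]; exact h2 k hk⟩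

/-- Once the source has transmitted to some node, the last updated node has the freshest version. -/
theorem IsRegular.exists_isLastUpdated (hω : G.IsRegular ω) (t : ℝ≥0) :
    (∀ k, G.count (.deliver k) t ω = 0) ∨
      ∃ j, G.IsLastUpdated j t ω ∧ ∀ k, (G.state t ω).node k ≤ (G.state t ω).node j := by
  refine hω.induction (Q := fun t => (∀ k, G.count (.deliver k) t ω = 0) ∨
      ∃ j, G.IsLastUpdated j t ω ∧ ∀ k, (G.state t ω).node k ≤ (G.state t ω).node j)
      (zero_le : 0 ≤ t) (.inl fun k => G.count_zero _ _) ?_ ?_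
  · intro a b _ hab hno h hQ
    rcases hQ with hQ | ⟨j, hj, hm⟩
    · exact .inl fun k => (hno _).trans (hQ k)
    · refine .inr ⟨j, hj.persist hab.le fun k => hno _, ?_⟩
      rw [h]; exact hm
  · intro a b e _ hab ho h hQ
    rcases e with _ | i | ⟨l, i⟩
    · have hd : ∀ k, G.count (.deliver k) b ω = G.count (.deliver k) a ω :=
        fun k => ho.2 _ (by simp)
      rcases hQ with hQ | ⟨j, hj, hm⟩
      · exact .inl fun k => (hd k).trans (hQ k)
      · refine .inr ⟨j, hj.persist hab.le hd, ?_⟩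
        rw [h]; exact hm
    -- The cell `(a, b]` itself witnesses `IsLastUpdated`, and the delivered version is the source's
    -- own.
    · refine .inr ⟨i, ⟨a, hab, ?_, fun k hk => ho.2 _ (by simpa using hk)⟩, fun k => ?_⟩
      · have := ho.1; simp only at this; omega
      · rw [h]
        by_cases hk : k = i
        · rw [hk]
        · simpa [Versions.step, hk] using hω.node_le_source a k
    · have hd : ∀ k, G.count (.deliver k) b ω = G.count (.deliver k) a ω :=
        fun k => ho.2 _ (by simp)
      rcases hQ with hQ | ⟨j, hj, hm⟩
      · exact .inl fun k => (hd k).trans (hQ k)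
      · refine .inr ⟨j, hj.persist hab.le hd, fun k => ?_⟩
        rw [h]
        -- The freshest node may itself be the receiver; its version does not decrease, and the
        -- other versions stay below its old one.
        have hj' : (G.state a ω).node j ≤ ((G.state a ω).step (.gossip l i)).node j := by
          by_cases hji : j = i
          · subst hji; simp [Versions.step]
          · simp [Versions.step, hji]
        refine le_trans ?_ hj'
        by_cases hk : k = i
        · subst hk; simpa [Versions.step] using ⟨hm l, hm k⟩
        · simpa [Versions.step, hk] using hm k

/-- Of two witnessing windows ending at t, the longer contains the shorter, hence a transmission
that it excludes. Thus at most one node gossips at a time, which keeps the scheme within its budget.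
-/
theorem isLastUpdated_unique {i k : Fin n} {t : ℝ≥0} (hi : G.IsLastUpdated i t ω)
    (hk : G.IsLastUpdated k t ω) : i = k := by
  by_contra hne
  obtain ⟨s, hs, h1, h2⟩ := hi
  obtain ⟨s', hs', h1', h2'⟩ := hk
  have a1 := h2 k (Ne.symm hne)
  have a2 := h2' i hne
  rcases le_total s s' with h | h
  · have := G.count_mono (.deliver k) ω h
    simp only at this; omega
  · have := G.count_mono (.deliver i) ω h
    simp only at this; omega

end GossipNetwork

/-! ### Auxiliary facts on integrals. -/

section General

/-- The densities f and g define the same measure on the smaller σ-algebra, and an `m`-measurable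
weight sees only that. It extends the martingale property from past events to past weights without
integrability. -/
theorem lintegral_mul_eq_of_setLIntegral_eq {Ω : Type*} {m m0 : MeasurableSpace Ω} {P : Measure Ω}
    (hm : m ≤ m0) {f g : Ω → ℝ≥0∞} (hf : Measurable f) (hg : Measurable g)
    (h : ∀ A, MeasurableSet[m] A → ∫⁻ ω in A, f ω ∂P = ∫⁻ ω in A, g ω ∂P) {W : Ω → ℝ≥0∞}
    (hW : Measurable[m] W) : ∫⁻ ω, W ω * f ω ∂P = ∫⁻ ω, W ω * g ω ∂P := by
  have key : ∀ k : Ω → ℝ≥0∞, Measurable k →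
      ∫⁻ ω, W ω * k ω ∂P = ∫⁻ ω, W ω ∂((P.withDensity k).trim hm) := by
    intro k hk
    rw [lintegral_trim hm hW, lintegral_withDensity_eq_lintegral_mul _ hk (hW.mono hm le_rfl)]
    exact lintegral_congr fun ω => mul_comm _ _
  have he : (P.withDensity f).trim hm = (P.withDensity g).trim hm := by
    refine @Measure.ext _ m _ _ fun A hA => ?_
    rw [trim_measurableSet_eq hm hA, trim_measurableSet_eq hm hA, withDensity_apply _ (hm _ hA),
      withDensity_apply _ (hm _ hA), h A hA]
  rw [key f hf, key g hg, he]

theorem lintegral_id_poissonMeasure (r : ℝ≥0) : ∫⁻ k : ℕ, (k : ℝ≥0∞) ∂poissonMeasure r = r := by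
  have hs : HasSum (fun k : ℕ => (k : ℝ) * (Real.exp (-r) * r ^ k / (k.factorial : ℝ))) r := by
    -- The term at 0 vanishes, and the term at k + 1 is r times the Poisson weight of k.
    rw [← hasSum_nat_add_iff' 1]
    have := (hasSum_one_poissonMeasure r).mul_left (r : ℝ)
    simp only [mul_one] at this
    convert! this using 1
    · funext k
      rw [Nat.factorial_succ]
      push_cast
      field_simp
      ring
    · simp
  rw [lintegral_countable']
  have : ∀ k : ℕ, (k : ℝ≥0∞) * poissonMeasure r {k} =
      ENNReal.ofReal ((k : ℝ) * (Real.exp (-r) * r ^ k / (k.factorial : ℝ))) := by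
    intro k
    rw [poissonMeasure_singleton, ENNReal.ofReal_mul (by positivity), ENNReal.ofReal_natCast]
  simp_rw [this]
  rw [← ENNReal.ofReal_tsum_of_nonneg (fun k => by positivity) hs.summable, hs.tsum_eq,
    ENNReal.ofReal_coe_nnreal]

theorem integrable_and_integral_eq_of_lintegral_eq {Ω : Type*} [MeasurableSpace Ω] {P : Measure Ω}
    {f g : Ω → ℝ} (hf : AEStronglyMeasurable f P) (hf0 : 0 ≤ᵐ[P] f) (hg : Integrable g P)
    (hg0 : 0 ≤ᵐ[P] g)
    (h : ∫⁻ ω, ENNReal.ofReal (f ω) ∂P = ∫⁻ ω, ENNReal.ofReal (g ω) ∂P) :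
    Integrable f P ∧ ∫ ω, f ω ∂P = ∫ ω, g ω ∂P := by
  have hfi : Integrable f P := by
    refine ⟨hf, ?_⟩
    rw [hasFiniteIntegral_iff_ofReal hf0, h]
    exact (hasFiniteIntegral_iff_ofReal hg0).1 hg.2
  refine ⟨hfi, ?_⟩
  rw [integral_eq_lintegral_of_nonneg_ae hf0 hf, integral_eq_lintegral_of_nonneg_ae hg0 hg.1, h]

end General

/-! ### Expected increments of the counting processes, weighted by the past. -/

namespace GossipNetwork

variable {Ω : Type*} [MeasurableSpace Ω] {P : Measure Ω} {n : ℕ} {lamE lam : ℝ≥0}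
  (G : GossipNetwork P n lamE lam)

theorem measurable_inc_filtration (e : GossipEvent n) {s t : ℝ≥0} (hst : s ≤ t) :
    Measurable[G.ℱ t] (G.inc e s t) :=
  Measurable.sub (G.count_adapted e t) ((G.count_adapted e s).mono (G.ℱ.mono hst) le_rfl)

theorem measurable_inc (e : GossipEvent n) (s t : ℝ≥0) : Measurable (G.inc e s t) :=
  Measurable.sub ((G.count_adapted e t).mono (G.ℱ.le t) le_rfl)
    ((G.count_adapted e s).mono (G.ℱ.le s) le_rfl)

/-- The increment is independent of `ℱ s`, so the integral factors, one factor being a Poisson mean.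
-/
theorem lintegral_mul_source (o : Option (Fin n)) {s t : ℝ≥0} (hst : s ≤ t) {W : Ω → ℝ≥0∞}
    (hW : Measurable[G.ℱ s] W) :
    ∫⁻ ω, W ω * G.inc (sourceEvent o) s t ω ∂P =
      ((sourceRate lamE lam o * (t - s) : ℝ≥0) : ℝ≥0∞) * ∫⁻ ω, W ω ∂P := by
  have hle : MeasurableSpace.comap (fun ω (o : Option (Fin n)) =>
      G.count (sourceEvent o) t ω - G.count (sourceEvent o) s ω) inferInstance ≤ ‹_› :=
    Measurable.comap_le (measurable_pi_lambda _ fun o => G.measurable_inc _ s t)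
  have hmeas : Measurable[MeasurableSpace.comap (fun ω (o : Option (Fin n)) =>
      G.count (sourceEvent o) t ω - G.count (sourceEvent o) s ω) inferInstance]
      (fun ω => (G.inc (sourceEvent o) s t ω : ℝ≥0∞)) :=
    Measurable.comp (g := fun v : Option (Fin n) → ℕ => ((v o : ℕ) : ℝ≥0∞))
      (measurable_from_nat.comp (measurable_pi_apply o)) (comap_measurable _)
  have h := lintegral_mul_eq_lintegral_mul_lintegral_of_independent_measurableSpace hle (G.ℱ.le s)
    (G.source_indep_past s t hst) hmeas hW
  simp_rw [mul_comm (W _)]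
  rw [h]
  congr 1
  have hl := (G.source_law o s t hst).lintegral_comp (f := fun k : ℕ => (k : ℝ≥0∞))
    (measurable_from_nat.aemeasurable)
  rw [lintegral_id_poissonMeasure] at hl
  exact hl

/-- Progressive measurability concerns bounded time windows, so time is stopped at T and T is sent
to infinity. -/
theorem measurable_rate_time (j : Fin n) (ω : Ω) : Measurable fun x => G.rate j x ω := by
  have hT : ∀ T : ℕ, Measurable fun x : ℝ≥0 => G.rate j (min x T) ω := by
    intro T
    have h : Measurable fun p : Set.Iic (T : ℝ≥0) × Ω => G.rate j p.1 p.2 :=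
      (G.rate_progressive j T).measurable.mono
        (sup_le_sup le_rfl (MeasurableSpace.comap_mono (G.ℱ.le T))) le_rfl
    have hm : Measurable fun x : ℝ≥0 => (⟨min x T, min_le_right x (T : ℝ≥0)⟩ : Set.Iic (T : ℝ≥0)) :=
      (measurable_id.min measurable_const).subtype_mk
    exact h.comp (hm.prodMk measurable_const)
  refine measurable_of_tendsto_metrizable hT (tendsto_pi_nhds.2 fun x => ?_)
  refine tendsto_const_nhds.congr' ?_
  obtain ⟨N, hN⟩ := exists_nat_ge x
  filter_upwards [eventually_ge_atTop N] with T hT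
  rw [min_eq_left (hN.trans (by exact_mod_cast hT))]

/-- The stochastic intensity of the transmissions `j → i`. -/
noncomputable def gossipRate (j i : Fin n) (t : ℝ≥0) (ω : Ω) : ℝ :=
  if j = i then 0 else G.rate j t ω / ((n : ℝ) - 1)

/-- The compensator of the transmissions `j → i` over `(s, t]`. -/
noncomputable def compensator (j i : Fin n) (s t : ℝ≥0) (ω : Ω) : ℝ :=
  ∫ x in (s : ℝ)..t, G.gossipRate j i x.toNNReal ω

variable {G} {B : ℝ≥0}

theorem TotalRateLE.rate_le (hG : G.TotalRateLE B) (j : Fin n) (t : ℝ≥0) (ω : Ω) :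
    G.rate j t ω ≤ B :=
  (Finset.single_le_sum (f := fun j => G.rate j t ω) (fun k _ => G.rate_nonneg k t ω)
    (Finset.mem_univ j)).trans (hG t ω)

theorem gossipRate_nonneg (hn : 2 ≤ n) (j i : Fin n) (t : ℝ≥0) (ω : Ω) :
    0 ≤ G.gossipRate j i t ω := by
  have : (2 : ℝ) ≤ n := by exact_mod_cast hn
  unfold gossipRate
  split_ifs
  · exact le_rfl
  · exact div_nonneg (G.rate_nonneg j t ω) (by linarith)

theorem gossipRate_le_rate (hn : 2 ≤ n) (j i : Fin n) (t : ℝ≥0) (ω : Ω) :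
    G.gossipRate j i t ω ≤ G.rate j t ω / ((n : ℝ) - 1) := by
  have : (2 : ℝ) ≤ n := by exact_mod_cast hn
  unfold gossipRate
  split_ifs
  · exact div_nonneg (G.rate_nonneg j t ω) (by linarith)
  · exact le_rfl

theorem TotalRateLE.gossipRate_le (hn : 2 ≤ n) (hG : G.TotalRateLE B) (j i : Fin n) (t : ℝ≥0)
    (ω : Ω) : G.gossipRate j i t ω ≤ B / ((n : ℝ) - 1) := by
  have : (2 : ℝ) ≤ n := by exact_mod_cast hn
  refine (gossipRate_le_rate hn j i t ω).trans ?_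
  exact div_le_div_of_nonneg_right (hG.rate_le j t ω) (by linarith)

theorem TotalRateLE.intervalIntegrable (hn : 2 ≤ n) (hG : G.TotalRateLE B) (j i : Fin n) (ω : Ω)
    (a b : ℝ) : IntervalIntegrable (fun x => G.gossipRate j i x.toNNReal ω) volume a b := by
  refine (intervalIntegrable_const (c := (B : ℝ) / ((n : ℝ) - 1))).mono_fun' ?_ ?_
  · refine Measurable.aestronglyMeasurable ?_
    unfold gossipRate
    split_ifs
    · exact measurable_const
    · exact ((G.measurable_rate_time j ω).comp measurable_real_toNNReal).div_const _
  · refine Eventually.of_forall fun x => ?_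
    simp only [Real.norm_eq_abs]
    rw [abs_of_nonneg (gossipRate_nonneg hn _ _ _ _)]
    exact hG.gossipRate_le hn _ _ _ _

theorem compensator_nonneg (hn : 2 ≤ n) (j i : Fin n) {s t : ℝ≥0} (hst : s ≤ t) (ω : Ω) :
    0 ≤ G.compensator j i s t ω :=
  intervalIntegral.integral_nonneg (NNReal.coe_le_coe.2 hst)
    fun _ _ => gossipRate_nonneg hn _ _ _ _

/-- The budget enters here: node i receives the share 1/(n-1) of what its senders spend. -/
theorem TotalRateLE.sum_compensator_le (hn : 2 ≤ n) (hG : G.TotalRateLE B) (i : Fin n)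
    {s t : ℝ≥0} (hst : s ≤ t) (ω : Ω) :
    ∑ j, G.compensator j i s t ω ≤ B / ((n : ℝ) - 1) * ((t : ℝ) - s) := by
  have hn' : (2 : ℝ) ≤ n := by exact_mod_cast hn
  unfold compensator
  rw [← intervalIntegral.integral_finsetSum fun j _ => hG.intervalIntegrable hn j i ω _ _]
  have : ∫ x in (s : ℝ)..t, (B : ℝ) / ((n : ℝ) - 1) = B / ((n : ℝ) - 1) * ((t : ℝ) - s) := by
    rw [intervalIntegral.integral_const, smul_eq_mul, mul_comm]
  rw [← this]
  refine intervalIntegral.integral_mono_on (NNReal.coe_le_coe.2 hst) ?_ intervalIntegrable_const ?_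
  · have := IntervalIntegrable.sum Finset.univ
      fun j _ => hG.intervalIntegrable hn j i ω (s : ℝ) (t : ℝ)
    convert! this using 1
    funext x; simp
  · intro x _
    refine (Finset.sum_le_sum fun j _ => gossipRate_le_rate hn j i _ ω).trans ?_
    rw [← Finset.sum_div]
    exact div_le_div_of_nonneg_right (hG _ ω) (by linarith)

theorem TotalRateLE.compensator_le (hn : 2 ≤ n) (hG : G.TotalRateLE B) (j i : Fin n)
    {s t : ℝ≥0} (hst : s ≤ t) (ω : Ω) :
    G.compensator j i s t ω ≤ B / ((n : ℝ) - 1) * ((t : ℝ) - s) :=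
  (Finset.single_le_sum (f := fun j => G.compensator j i s t ω)
    (fun k _ => compensator_nonneg hn k i hst ω) (Finset.mem_univ j)).trans
    (hG.sum_compensator_le hn i hst ω)

theorem TotalRateLE.compensator_sub (hn : 2 ≤ n) (hG : G.TotalRateLE B) (j i : Fin n)
    (s t : ℝ≥0) (ω : Ω) :
    G.compensator j i 0 t ω - G.compensator j i 0 s ω = G.compensator j i s t ω := by
  unfold compensator
  exact intervalIntegral.integral_interval_sub_left (hG.intervalIntegrable hn j i ω _ _)
    (hG.intervalIntegrable hn j i ω _ _)

theorem martingale_compensated (G : GossipNetwork P n lamE lam) (j i : Fin n) : Martingale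
    (fun t ω => (G.count (.gossip j i) t ω : ℝ) - G.compensator j i 0 t ω) G.ℱ P := by
  have := G.gossip_intensity j i
  simpa only [compensator, gossipRate, NNReal.coe_zero] using this

/-- The compensator is the count minus the martingale, so no Fubini argument is needed. -/
theorem measurable_compensator_zero (G : GossipNetwork P n lamE lam) (j i : Fin n) (t : ℝ≥0) :
    Measurable (G.compensator j i 0 t) := by
  have h1 := ((G.martingale_compensated j i).1 t).measurable.mono (G.ℱ.le t) le_rfl
  have h2 : Measurable fun ω => (G.count (.gossip j i) t ω : ℝ) :=
    measurable_from_nat.comp ((G.count_adapted _ t).mono (G.ℱ.le t) le_rfl)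
  have := h2.sub h1
  convert! this using 1
  funext ω; simp

theorem TotalRateLE.measurable_compensator (hn : 2 ≤ n) (hG : G.TotalRateLE B) (j i : Fin n)
    (s t : ℝ≥0) : Measurable (G.compensator j i s t) := by
  have := (G.measurable_compensator_zero j i t).sub (G.measurable_compensator_zero j i s)
  convert! this using 1
  funext ω; exact (hG.compensator_sub hn j i s t ω).symm

theorem TotalRateLE.integrable_compensator [IsProbabilityMeasure P] (hn : 2 ≤ n)
    (hG : G.TotalRateLE B) (j i : Fin n) {s t : ℝ≥0} (hst : s ≤ t) :
    Integrable (G.compensator j i s t) P := by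
  refine Integrable.mono' (integrable_const (B / ((n : ℝ) - 1) * ((t : ℝ) - s)))
    (hG.measurable_compensator hn j i s t).aestronglyMeasurable (Eventually.of_forall fun ω => ?_)
  rw [Real.norm_eq_abs, abs_of_nonneg (compensator_nonneg hn j i hst ω)]
  exact hG.compensator_le hn j i hst ω

theorem inc_cast (e : GossipEvent n) {s t : ℝ≥0} (hst : s ≤ t) (ω : Ω) :
    (G.inc e s t ω : ℝ) = G.count e t ω - G.count e s ω :=
  Nat.cast_sub (G.count_mono e ω hst)

theorem TotalRateLE.lintegral_mul_gossip [IsProbabilityMeasure P] (hn : 2 ≤ n)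
    (hG : G.TotalRateLE B) (j i : Fin n) {s t : ℝ≥0} (hst : s ≤ t) {W : Ω → ℝ≥0∞}
    (hW : Measurable[G.ℱ s] W) :
    ∫⁻ ω, W ω * G.inc (.gossip j i) s t ω ∂P =
      ∫⁻ ω, W ω * ENNReal.ofReal (G.compensator j i s t ω) ∂P := by
  refine lintegral_mul_eq_of_setLIntegral_eq (G.ℱ.le s)
    (measurable_from_nat.comp (G.measurable_inc _ s t))
    (ENNReal.measurable_ofReal.comp (hG.measurable_compensator hn j i s t)) ?_ hW
  intro A hA
  have hM := G.martingale_compensated j i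
  have hcomp := fun t : ℝ≥0 => hG.integrable_compensator hn j i (zero_le : 0 ≤ t)
  -- A count is an integrable martingale plus a bounded compensator.
  have hcnt : ∀ t, Integrable (fun ω => (G.count (.gossip j i) t ω : ℝ)) P := by
    intro t
    have := (hM.integrable t).add (hcomp t)
    convert! this using 1
    funext ω; simp
  have hinc : Integrable (fun ω => (G.inc (.gossip j i) s t ω : ℝ)) P := by
    have := (hcnt t).sub (hcnt s)
    convert! this using 1
    funext ω; exact inc_cast _ hst ω
  have e1 : ∫ ω in A, (G.inc (.gossip j i) s t ω : ℝ) ∂P = ∫ ω in A, G.compensator j i s t ω ∂P := by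
    have h := hM.setIntegral_eq hst hA
    rw [integral_sub (hcnt s).integrableOn (hcomp s).integrableOn,
      integral_sub (hcnt t).integrableOn (hcomp t).integrableOn] at h
    have h1 : ∫ ω in A, (G.inc (.gossip j i) s t ω : ℝ) ∂P =
        ∫ ω in A, (G.count (.gossip j i) t ω : ℝ) ∂P - ∫ ω in A, (G.count (.gossip j i) s ω : ℝ) ∂P := by
      rw [← integral_sub (hcnt t).integrableOn (hcnt s).integrableOn]
      exact integral_congr_ae (Eventually.of_forall fun ω => inc_cast _ hst ω)
    have h2 : ∫ ω in A, G.compensator j i s t ω ∂P =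
        ∫ ω in A, G.compensator j i 0 t ω ∂P - ∫ ω in A, G.compensator j i 0 s ω ∂P := by
      rw [← integral_sub (hcomp t).integrableOn (hcomp s).integrableOn]
      exact integral_congr_ae (Eventually.of_forall fun ω => (hG.compensator_sub hn j i s t ω).symm)
    rw [h1, h2]; linarith
  have e2 := ofReal_integral_eq_lintegral_ofReal (hinc.integrableOn (s := A))
    (Eventually.of_forall fun ω => Nat.cast_nonneg _)
  have e3 := ofReal_integral_eq_lintegral_ofReal
    ((hG.integrable_compensator hn j i hst).integrableOn (s := A))
    (Eventually.of_forall fun ω => compensator_nonneg hn j i hst ω)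
  simp only [ENNReal.ofReal_natCast] at e2
  exact e2.symm.trans ((congrArg _ e1).trans e3)

theorem integral_mul_source (o : Option (Fin n)) {s t : ℝ≥0} (hst : s ≤ t) {W : Ω → ℝ}
    (hW : Measurable[G.ℱ s] W) (hW0 : 0 ≤ᵐ[P] W) (hWi : Integrable W P) :
    Integrable (fun ω => W ω * G.inc (sourceEvent o) s t ω) P ∧
      ∫ ω, W ω * G.inc (sourceEvent o) s t ω ∂P =
        (sourceRate lamE lam o : ℝ) * ((t : ℝ) - s) * ∫ ω, W ω ∂P := by
  have hWm : Measurable W := hW.mono (G.ℱ.le s) le_rfl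
  have hr : 0 ≤ (sourceRate lamE lam o : ℝ) * ((t : ℝ) - s) :=
    mul_nonneg (NNReal.coe_nonneg _) (sub_nonneg.2 (NNReal.coe_le_coe.2 hst))
  rw [← integral_const_mul]
  refine integrable_and_integral_eq_of_lintegral_eq ?_ ?_ (hWi.const_mul _) ?_ ?_
  · exact (hWm.mul (measurable_from_nat.comp (G.measurable_inc _ s t))).aestronglyMeasurable
  · filter_upwards [hW0] with ω h using mul_nonneg h (Nat.cast_nonneg _)
  · filter_upwards [hW0] with ω h using mul_nonneg hr h
  · have h := G.lintegral_mul_source o hst (W := fun ω => ENNReal.ofReal (W ω))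
      (ENNReal.measurable_ofReal.comp hW)
    simp_rw [ENNReal.ofReal_mul hr]
    rw [lintegral_const_mul _ hWm.ennreal_ofReal]
    calc _ = ∫⁻ ω, ENNReal.ofReal (W ω) * G.inc (sourceEvent o) s t ω ∂P := by
          refine lintegral_congr_ae ?_
          filter_upwards [hW0] with ω hω
          rw [ENNReal.ofReal_mul hω, ENNReal.ofReal_natCast]
      _ = _ := by
          rw [h]; congr 1
          rw [← NNReal.coe_sub hst, ← NNReal.coe_mul, ENNReal.ofReal_coe_nnreal]

theorem TotalRateLE.integrable_mul_compensator [IsProbabilityMeasure P] (hn : 2 ≤ n)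
    (hG : G.TotalRateLE B) (j i : Fin n) {s t : ℝ≥0} (hst : s ≤ t) {W : Ω → ℝ}
    (hWi : Integrable W P) : Integrable (fun ω => W ω * G.compensator j i s t ω) P := by
  refine hWi.mul_bdd (c := B / ((n : ℝ) - 1) * ((t : ℝ) - s))
    (hG.measurable_compensator hn j i s t).aestronglyMeasurable (Eventually.of_forall fun ω => ?_)
  rw [Real.norm_eq_abs, abs_of_nonneg (compensator_nonneg hn j i hst ω)]
  exact hG.compensator_le hn j i hst ω

theorem TotalRateLE.integral_mul_gossip [IsProbabilityMeasure P] (hn : 2 ≤ n)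
    (hG : G.TotalRateLE B) (j i : Fin n) {s t : ℝ≥0} (hst : s ≤ t) {W : Ω → ℝ}
    (hW : Measurable[G.ℱ s] W) (hW0 : 0 ≤ᵐ[P] W) (hWi : Integrable W P) :
    Integrable (fun ω => W ω * G.inc (.gossip j i) s t ω) P ∧
      ∫ ω, W ω * G.inc (.gossip j i) s t ω ∂P = ∫ ω, W ω * G.compensator j i s t ω ∂P := by
  have hWm : Measurable W := hW.mono (G.ℱ.le s) le_rfl
  refine integrable_and_integral_eq_of_lintegral_eq ?_ ?_
    (hG.integrable_mul_compensator hn j i hst hWi) ?_ ?_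
  · exact (hWm.mul (measurable_from_nat.comp (G.measurable_inc _ s t))).aestronglyMeasurable
  · filter_upwards [hW0] with ω h using mul_nonneg h (Nat.cast_nonneg _)
  · filter_upwards [hW0] with ω h using mul_nonneg h (compensator_nonneg hn j i hst ω)
  · have h := hG.lintegral_mul_gossip hn j i hst (W := fun ω => ENNReal.ofReal (W ω))
      (ENNReal.measurable_ofReal.comp hW)
    calc _ = ∫⁻ ω, ENNReal.ofReal (W ω) * G.inc (.gossip j i) s t ω ∂P := by
          refine lintegral_congr_ae ?_
          filter_upwards [hW0] with ω hω
          rw [ENNReal.ofReal_mul hω, ENNReal.ofReal_natCast]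
      _ = _ := by
          rw [h]
          refine lintegral_congr_ae ?_
          filter_upwards [hW0] with ω hω
          rw [ENNReal.ofReal_mul hω]

end GossipNetwork

/-! ### Several events in a short interval: a bound of second order. -/

/-- Events beyond the first come from crowded cells or from pairs of occupied cells. Subtraction is
truncated: adding b events to a raises the excess by more than b - 1 only if both are positive, and
then by one more, at most a * b. -/
theorem sum_sub_one_le (N : ℕ → ℕ) (m : ℕ) :
    (∑ k ∈ Finset.range m, N k) - 1 ≤
      ∑ k ∈ Finset.range m, (N k - 1) + ∑ k ∈ Finset.range m, (∑ l ∈ Finset.range k, N l) * N k := by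
  induction m with
  | zero => simp
  | succ m ih =>
    rw [Finset.sum_range_succ, Finset.sum_range_succ, Finset.sum_range_succ]
    generalize (∑ k ∈ Finset.range m, N k) = a at *
    generalize N m = b at *
    have : a + b - 1 ≤ (a - 1) + (b - 1) + a * b := by
      rcases Nat.eq_zero_or_pos a with rfl | ha
      · omega
      rcases Nat.eq_zero_or_pos b with rfl | hb
      · omega
      have := Nat.mul_pos ha hb
      omega
    omega

theorem measurable_mul_natCast {Ω : Type*} {m : MeasurableSpace Ω} {W : Ω → ℝ≥0∞} {f : Ω → ℕ}
    (hW : Measurable W) (hf : Measurable f) : Measurable fun ω => W ω * (f ω : ℝ≥0∞) :=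
  hW.mul (measurable_from_nat.comp hf)

namespace GossipNetwork

variable {Ω : Type*} [MeasurableSpace Ω] {P : Measure Ω} {n : ℕ} {lamE lam : ℝ≥0}
  {G : GossipNetwork P n lamE lam} {B : ℝ≥0}

/-- A bound on the total rate of events when the total gossip rate is at most `B`. -/
noncomputable def eventRateBound (n : ℕ) (lamE lam B : ℝ≥0) : ℝ≥0 :=
  ∑ o : Option (Fin n), sourceRate lamE lam o +
    ∑ _p : Fin n × Fin n, ((B : ℝ) / ((n : ℝ) - 1)).toNNReal

theorem measurable_totalInc (G : GossipNetwork P n lamE lam) (s t : ℝ≥0) :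
    Measurable (G.totalInc s t) :=
  Finset.measurable_sum _ fun x _ => G.measurable_inc (eventOf x) s t

theorem measurable_totalInc_filtration (G : GossipNetwork P n lamE lam) {s t : ℝ≥0} (hst : s ≤ t) :
    Measurable[G.ℱ t] (G.totalInc s t) :=
  Finset.measurable_sum _ fun x _ => G.measurable_inc_filtration (eventOf x) hst

theorem TotalRateLE.lintegral_mul_totalInc_le [IsProbabilityMeasure P] (hn : 2 ≤ n)
    (hG : G.TotalRateLE B) {s t : ℝ≥0} (hst : s ≤ t) {W : Ω → ℝ≥0∞} (hW : Measurable[G.ℱ s] W) :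
    ∫⁻ ω, W ω * G.totalInc s t ω ∂P ≤
      ((eventRateBound n lamE lam B * (t - s) : ℝ≥0) : ℝ≥0∞) * ∫⁻ ω, W ω ∂P := by
  have hWm : Measurable W := hW.mono (G.ℱ.le s) le_rfl
  have hn' : (2 : ℝ) ≤ n := by exact_mod_cast hn
  simp only [totalInc, Nat.cast_sum, Finset.mul_sum]
  rw [lintegral_finsetSum _ fun x _ =>
    measurable_mul_natCast hWm (G.measurable_inc (eventOf x) s t), Fintype.sum_sum_type]
  simp only [eventRateBound, add_mul, ENNReal.coe_add, Finset.sum_mul, ENNReal.ofNNReal_finsetSum]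
  refine add_le_add (Finset.sum_le_sum fun o _ => ?_) (Finset.sum_le_sum fun p _ => ?_)
  · exact (G.lintegral_mul_source o hst hW).le
  · change ∫⁻ ω, W ω * G.inc (.gossip p.1 p.2) s t ω ∂P ≤ _
    rw [hG.lintegral_mul_gossip hn p.1 p.2 hst hW, ← lintegral_const_mul _ hWm]
    refine lintegral_mono fun ω => ?_
    rw [mul_comm]
    gcongr
    refine (ENNReal.ofReal_le_ofReal (hG.compensator_le hn p.1 p.2 hst ω)).trans (le_of_eq ?_)
    rw [← NNReal.coe_sub hst, ← ENNReal.ofReal_coe_nnreal, NNReal.coe_mul, Real.coe_toNNReal]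
    exact div_nonneg B.2 (by linarith)

/-- Two or more events in a short interval are unlikely, whatever the past. -/
theorem TotalRateLE.lintegral_mul_totalInc_sub_one_le [IsProbabilityMeasure P] (hn : 2 ≤ n)
    (hG : G.TotalRateLE B) (s h : ℝ≥0) {W : Ω → ℝ≥0∞} (hW : Measurable[G.ℱ s] W)
    (hWi : ∫⁻ ω, W ω ∂P ≠ ∞) :
    ∫⁻ ω, W ω * ((G.totalInc s (s + h) ω - 1 : ℕ) : ℝ≥0∞) ∂P ≤
      (((eventRateBound n lamE lam B * h) ^ 2 : ℝ≥0) : ℝ≥0∞) * ∫⁻ ω, W ω ∂P := by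
  set γ := eventRateBound n lamE lam B
  have hWm : Measurable W := hW.mono (G.ℱ.le s) le_rfl
  let N : ℕ → ℕ → Ω → ℕ := fun m k => G.totalInc (meshPoint s h m k) (meshPoint s h m (k + 1))
  have hNm : ∀ m k, Measurable (N m k) := fun m k => G.measurable_totalInc _ _
  have hsum : ∀ m k ω, ∑ l ∈ Finset.range k, N m l ω = G.totalInc s (meshPoint s h m k) ω := by
    intro m k ω
    induction k with
    | zero => simp [meshPoint_zero, totalInc, inc]
    | succ k ih =>
      rw [Finset.sum_range_succ, ih, totalInc_add (t := meshPoint s h m k) le_self_add (meshPoint_mono s h m k.le_succ)]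
  let D : ℕ → Ω → ℕ := fun m ω => ∑ k ∈ Finset.range (m + 1), (N m k ω - 1)
  have hDm : ∀ m, Measurable (D m) := fun m =>
    Finset.measurable_sum _ fun k _ => (hNm m k).sub_const 1
  -- Crowded cells vanish on each regular path once the mesh is fine; the total number of events
  -- dominates.
  have hDlim : Tendsto (fun m => ∫⁻ ω, W ω * (D m ω : ℝ≥0∞) ∂P) atTop (𝓝 0) := by
    have h0 : ∫⁻ ω, (0 : ℝ≥0∞) ∂P = 0 := by simp
    rw [← h0]
    refine tendsto_lintegral_of_dominated_convergence
      (fun ω => W ω * (G.totalInc s (s + h) ω : ℝ≥0∞)) ?_ ?_ ?_ ?_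
    · intro m; exact measurable_mul_natCast hWm (hDm m)
    · intro m
      refine Eventually.of_forall fun ω => ?_
      dsimp only
      gcongr
      rw [← meshPoint_last s h m, ← hsum]
      exact Finset.sum_le_sum fun k _ => Nat.sub_le _ _
    · refine ne_top_of_le_ne_top ?_ (hG.lintegral_mul_totalInc_le hn le_self_add hW)
      exact ENNReal.mul_ne_top ENNReal.coe_ne_top hWi
    · filter_upwards [G.ae_isRegular] with ω hω
      refine tendsto_const_nhds.congr' ?_
      filter_upwards [eventually_mesh (c := fun e r => G.count e r ω) (fun e => G.count_mono e ω)
        (fun e => G.count_right e ω) hω s h] with m hm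
      have : D m ω = 0 := Finset.sum_eq_zero fun k hk => by
        have : N m k ω ≤ 1 := (hm k (Finset.mem_range.1 hk)).sum_le_one
        omega
      simp [this]
  -- For pairs of cells, the events before cell k belong to its past, so the first-order bound
  -- applies twice: each of the m + 1 cells costs at most γ h/(m+1) · γ h, and the sum is (γ h)².
  have hbound : ∀ m, ∫⁻ ω, W ω * ((G.totalInc s (s + h) ω - 1 : ℕ) : ℝ≥0∞) ∂P ≤
      ∫⁻ ω, W ω * (D m ω : ℝ≥0∞) ∂P + (((γ * h) ^ 2 : ℝ≥0) : ℝ≥0∞) * ∫⁻ ω, W ω ∂P := by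
    intro m
    have hS : ∀ k, Measurable[G.ℱ (meshPoint s h m k)]
        fun ω => W ω * (G.totalInc s (meshPoint s h m k) ω : ℝ≥0∞) := fun k =>
      (hW.mono (G.ℱ.mono le_self_add) le_rfl).mul
        (measurable_from_nat.comp (G.measurable_totalInc_filtration le_self_add))
    have hSm : ∀ k, Measurable fun ω => W ω * (G.totalInc s (meshPoint s h m k) ω : ℝ≥0∞) :=
      fun k => (hS k).mono (G.ℱ.le _) le_rfl
    calc _ ≤ ∫⁻ ω, (W ω * (D m ω : ℝ≥0∞) + ∑ k ∈ Finset.range (m + 1),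
          W ω * (G.totalInc s (meshPoint s h m k) ω : ℝ≥0∞) * (N m k ω : ℝ≥0∞)) ∂P := by
          refine lintegral_mono fun ω => ?_
          have := sum_sub_one_le (fun k => N m k ω) (m + 1)
          simp only [hsum, meshPoint_last] at this
          simp only [mul_assoc]
          rw [← Finset.mul_sum, ← mul_add]
          gcongr
          exact_mod_cast this
      _ = ∫⁻ ω, W ω * (D m ω : ℝ≥0∞) ∂P + ∑ k ∈ Finset.range (m + 1),
          ∫⁻ ω, W ω * (G.totalInc s (meshPoint s h m k) ω : ℝ≥0∞) * (N m k ω : ℝ≥0∞) ∂P := by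
          rw [lintegral_add_left (measurable_mul_natCast hWm (hDm m)),
            lintegral_finsetSum _ fun k _ => measurable_mul_natCast (hSm k) (hNm m k)]
      _ ≤ ∫⁻ ω, W ω * (D m ω : ℝ≥0∞) ∂P + ∑ k ∈ Finset.range (m + 1),
          (((γ * (h / (m + 1)) * (γ * h) : ℝ≥0)) : ℝ≥0∞) * ∫⁻ ω, W ω ∂P := by
          gcongr with k hk
          have hk' : meshPoint s h m k ≤ s + h := by
            rw [← meshPoint_last s h m]
            exact meshPoint_mono _ _ _ (Finset.mem_range.1 hk).le
          refine (hG.lintegral_mul_totalInc_le hn (meshPoint_mono s h m k.le_succ) (hS k)).trans ?_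
          rw [meshPoint_succ, add_tsub_cancel_left, ENNReal.coe_mul (_ * _) (_ * _), mul_assoc]
          gcongr
          refine (hG.lintegral_mul_totalInc_le hn le_self_add hW).trans ?_
          gcongr
          exact tsub_le_iff_left.2 hk'
      _ = _ := by
          rw [Finset.sum_const, Finset.card_range, nsmul_eq_mul, ← mul_assoc]
          congr 2
          have : ((m + 1 : ℕ) : ℝ≥0∞) = (((m + 1 : ℕ) : ℝ≥0) : ℝ≥0∞) := by simp
          rw [this, ← ENNReal.coe_mul]
          congr 1
          have : (m : ℝ≥0) + 1 ≠ 0 := by positivity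
          push_cast
          field_simp
  have hlim := hDlim.add_const ((((γ * h) ^ 2 : ℝ≥0) : ℝ≥0∞) * ∫⁻ ω, W ω ∂P)
  rw [zero_add] at hlim
  exact ge_of_tendsto' hlim hbound

theorem TotalRateLE.integral_mul_totalInc_sub_one_le [IsProbabilityMeasure P] (hn : 2 ≤ n)
    (hG : G.TotalRateLE B) (s h : ℝ≥0) {W : Ω → ℝ} (hW : Measurable[G.ℱ s] W)
    (hW0 : 0 ≤ᵐ[P] W) (hWi : Integrable W P) :
    Integrable (fun ω => W ω * ((G.totalInc s (s + h) ω - 1 : ℕ) : ℝ)) P ∧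
      ∫ ω, W ω * ((G.totalInc s (s + h) ω - 1 : ℕ) : ℝ) ∂P ≤
        ((eventRateBound n lamE lam B : ℝ) * h) ^ 2 * ∫ ω, W ω ∂P := by
  have hWm : Measurable W := hW.mono (G.ℱ.le s) le_rfl
  have hm : AEStronglyMeasurable (fun ω => W ω * ((G.totalInc s (s + h) ω - 1 : ℕ) : ℝ)) P :=
    (hWm.mul (measurable_from_nat.comp
      ((G.measurable_totalInc s (s + h)).sub_const 1))).aestronglyMeasurable
  have h0 : 0 ≤ᵐ[P] fun ω => W ω * ((G.totalInc s (s + h) ω - 1 : ℕ) : ℝ) := by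
    filter_upwards [hW0] with ω h using mul_nonneg h (Nat.cast_nonneg _)
  have hfin := (hasFiniteIntegral_iff_ofReal hW0).1 hWi.2
  have key : ∫⁻ ω, ENNReal.ofReal (W ω * ((G.totalInc s (s + h) ω - 1 : ℕ) : ℝ)) ∂P ≤
      (((eventRateBound n lamE lam B * h) ^ 2 : ℝ≥0) : ℝ≥0∞) * ∫⁻ ω, ENNReal.ofReal (W ω) ∂P := by
    refine le_trans (le_of_eq (lintegral_congr_ae ?_))
      (hG.lintegral_mul_totalInc_sub_one_le hn s h (W := fun ω => ENNReal.ofReal (W ω))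
        (ENNReal.measurable_ofReal.comp hW) hfin.ne)
    filter_upwards [hW0] with ω hω
    rw [ENNReal.ofReal_mul hω, ENNReal.ofReal_natCast]
  have htop := ENNReal.mul_ne_top (a := (((eventRateBound n lamE lam B * h) ^ 2 : ℝ≥0) : ℝ≥0∞))
    ENNReal.coe_ne_top hfin.ne
  refine ⟨⟨hm, ?_⟩, ?_⟩
  · rw [hasFiniteIntegral_iff_ofReal h0]
    exact key.trans_lt htop.lt_top
  · rw [integral_eq_lintegral_of_nonneg_ae h0 hm, integral_eq_lintegral_of_nonneg_ae hW0 hWi.1]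
    refine (ENNReal.toReal_mono htop key).trans (le_of_eq ?_)
    rw [ENNReal.toReal_mul, ENNReal.coe_toReal]
    push_cast
    rfl

end GossipNetwork

/-! ### First-order change of the ages and of their means. -/

theorem Versions.sup_step_deliver {n : ℕ} (x : Versions n) (hx : ∀ i, x.node i ≤ x.source)
    (k : Fin n) : Finset.univ.sup (x.step (.deliver k)).node = x.source := by
  refine le_antisymm (Finset.sup_le fun i _ => ?_) ?_
  · by_cases hik : i = k
    · subst hik; simp [step]
    · simpa [step, hik] using hx i
  · have := Finset.le_sup (f := (x.step (.deliver k)).node) (Finset.mem_univ k)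
    simpa [step] using this

/-- This is why no gossip policy can influence the smallest age. -/
theorem Versions.sup_step_gossip {n : ℕ} (x : Versions n) (l k : Fin n) :
    Finset.univ.sup (x.step (.gossip l k)).node = Finset.univ.sup x.node := by
  have hle : ∀ i, x.node i ≤ Finset.univ.sup x.node :=
    fun i => Finset.le_sup (f := x.node) (Finset.mem_univ i)
  refine le_antisymm (Finset.sup_le fun i _ => ?_) (Finset.sup_mono_fun fun i _ => ?_)
  · by_cases hik : i = k
    · subst hik; simpa [step] using ⟨hle l, hle i⟩
    · simpa [step, hik] using hle i
  · by_cases hik : i = k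
    · subst hik; simp [step]
    · simp [step, hik]

namespace GossipNetwork

variable {Ω : Type*} [MeasurableSpace Ω] {P : Measure Ω} {n : ℕ} {lamE lam : ℝ≥0}
  {G : GossipNetwork P n lamE lam} {B : ℝ≥0} {ω : Ω}

/-- The amount by which a version from node `j` is fresher than that of node `i`. -/
def gain (G : GossipNetwork P n lamE lam) (j i : Fin n) (t : ℝ≥0) (ω : Ω) : ℝ :=
  max (G.age i t ω - G.age j t ω) 0

theorem gain_nonneg (j i : Fin n) (t : ℝ≥0) : 0 ≤ G.gain j i t ω := le_max_right _ _

theorem gain_le (j i : Fin n) (t : ℝ≥0) : G.gain j i t ω ≤ G.age i t ω - G.minAge t ω := by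
  have h1 := minAge_le_age (G := G) (ω := ω) t i
  have h2 := minAge_le_age (G := G) (ω := ω) t j
  exact max_le (by linarith) (by linarith)

theorem IsRegular.gain_le_age (hω : G.IsRegular ω) (j i : Fin n) (t : ℝ≥0) :
    G.gain j i t ω ≤ G.age i t ω :=
  (gain_le j i t).trans (by linarith [hω.minAge_nonneg t])

/-- The first order change of the age of node `i` over `(s, t]`. -/
def ageChange (G : GossipNetwork P n lamE lam) (i : Fin n) (s t : ℝ≥0) (ω : Ω) : ℝ :=
  G.inc .refresh s t ω - G.age i s ω * G.inc (.deliver i) s t ω -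
    ∑ j, G.gain j i s ω * G.inc (.gossip j i) s t ω

/-- The first order change of the minimal age over `(s, t]`. -/
def minAgeChange (G : GossipNetwork P n lamE lam) (s t : ℝ≥0) (ω : Ω) : ℝ :=
  G.inc .refresh s t ω - ∑ k, G.minAge s ω * G.inc (.deliver k) s t ω

theorem totalInc_eq (s t : ℝ≥0) : G.totalInc s t ω = G.inc .refresh s t ω +
    ∑ k, G.inc (.deliver k) s t ω + ∑ j, ∑ i, G.inc (.gossip j i) s t ω := by
  rw [totalInc, Fintype.sum_sum_type, Fintype.sum_option, Fintype.sum_prod_type]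
  rfl

theorem inc_eq_zero_of_noEvent {s t : ℝ≥0} (h : NoEvent (fun e r => G.count e r ω) s t)
    (e : GossipEvent n) : G.inc e s t ω = 0 := by
  have := h e
  simp only at this
  simp [inc, this]

open scoped Classical in
theorem inc_eq_ite_of_onlyEvent {s t : ℝ≥0} {e : GossipEvent n}
    (h : OnlyEvent (fun e r => G.count e r ω) e s t) (e' : GossipEvent n) :
    G.inc e' s t ω = if e' = e then 1 else 0 := by
  split_ifs with he
  · subst he
    have := h.1
    simp only at this
    simp [inc, this]
  · have := h.2 e' he
    simp only at this
    simp [inc, this]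

/-- The expansion is exact for at most one event, when the truncated `totalInc - 1` vanishes. For N
≥ 2 events crude bounds suffice, the factor 2 coming from N ≤ 2(N - 1). -/
theorem IsRegular.abs_age_sub_le (hω : G.IsRegular ω) (i : Fin n) {s t : ℝ≥0} (hst : s ≤ t) :
    |G.age i t ω - G.age i s ω - G.ageChange i s t ω| ≤
      2 * ((1 + G.age i s ω) * ((G.totalInc s t ω - 1 : ℕ) : ℝ)) := by
  have hs0 := hω.age_nonneg s i
  rcases (by omega : G.totalInc s t ω = 0 ∨ G.totalInc s t ω = 1 ∨ 2 ≤ G.totalInc s t ω)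
    with h | h | h
  · have hno := noEvent_of_sum_eq_zero (c := fun e r => G.count e r ω)
      (fun e => G.count_mono e ω) hst h
    simp only [ageChange, inc_eq_zero_of_noEvent hno, h]
    simp [age, G.state_const ω s t hst hno]
  · obtain ⟨e, he⟩ := onlyEvent_of_sum_eq_one (c := fun e r => G.count e r ω)
      (fun e => G.count_mono e ω) hst h
    have hz : G.age i t ω - G.age i s ω - G.ageChange i s t ω = 0 := by
      simp only [ageChange, inc_eq_ite_of_onlyEvent he]
      have hst' := G.state_step ω s t e hst he
      rcases e with _ | k | ⟨l, k⟩
      · simp [age, Versions.age, hst', Versions.step]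
      · by_cases hik : i = k
        · subst hik
          simp [age, Versions.age, hst', Versions.step]
        · simp [age, Versions.age, hst', Versions.step, hik]
      · by_cases hik : i = k
        · subst hik
          simp only [age, Versions.age, hst', Versions.step, gain]
          simp only [reduceCtorEq, if_false, Nat.cast_zero, mul_zero, sub_zero,
            GossipEvent.gossip.injEq, and_true, Function.update_self, Nat.cast_ite, Nat.cast_one,
            mul_ite, mul_one, Finset.sum_ite_eq', Finset.mem_univ, if_true, Nat.cast_max]
          rcases le_total ((G.state s ω).node l : ℝ) ((G.state s ω).node i : ℝ) with h' | h'
          · rw [max_eq_right h', max_eq_right (by linarith)]; ring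
          · rw [max_eq_left h', max_eq_left (by linarith)]; ring
        · simp [age, Versions.age, hst', Versions.step, hik]
    rw [hz, h]; simp
  · have hcast : ((G.totalInc s t ω - 1 : ℕ) : ℝ) = (G.totalInc s t ω : ℝ) - 1 := by
      rw [Nat.cast_sub (by omega), Nat.cast_one]
    have ht0 := hω.age_nonneg t i
    have htle := hω.age_le hst i
    have htot := totalInc_eq (G := G) (ω := ω) s t
    have hd : G.inc (.deliver i) s t ω ≤ ∑ k, G.inc (.deliver k) s t ω :=
      Finset.single_le_sum (f := fun k => G.inc (.deliver k) s t ω) (fun _ _ => Nat.zero_le _)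
        (Finset.mem_univ i)
    have hg : ∑ j, G.inc (.gossip j i) s t ω ≤ ∑ j, ∑ k, G.inc (.gossip j k) s t ω :=
      Finset.sum_le_sum fun j _ =>
        Finset.single_le_sum (f := fun k => G.inc (.gossip j k) s t ω) (fun _ _ => Nat.zero_le _)
          (Finset.mem_univ i)
    have hdg : (G.inc (.deliver i) s t ω : ℝ) + ∑ j, (G.inc (.gossip j i) s t ω : ℝ) ≤
        G.totalInc s t ω := by
      rw [← Nat.cast_sum]
      exact_mod_cast (by omega :
        G.inc (.deliver i) s t ω + ∑ j, G.inc (.gossip j i) s t ω ≤ G.totalInc s t ω)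
    have hν : (G.inc .refresh s t ω : ℝ) ≤ G.totalInc s t ω := by
      exact_mod_cast (by omega : G.inc .refresh s t ω ≤ G.totalInc s t ω)
    have hgs : ∑ j, G.gain j i s ω * (G.inc (.gossip j i) s t ω : ℝ) ≤
        G.age i s ω * ∑ j, (G.inc (.gossip j i) s t ω : ℝ) := by
      rw [Finset.mul_sum]
      exact Finset.sum_le_sum fun j _ =>
        mul_le_mul_of_nonneg_right (hω.gain_le_age j i s) (Nat.cast_nonneg _)
    have hgs0 : 0 ≤ ∑ j, G.gain j i s ω * (G.inc (.gossip j i) s t ω : ℝ) :=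
      Finset.sum_nonneg fun j _ => mul_nonneg (gain_nonneg j i s) (Nat.cast_nonneg _)
    have hN : (2 : ℝ) ≤ G.totalInc s t ω := by exact_mod_cast h
    have hd0 : 0 ≤ G.age i s ω * (G.inc (.deliver i) s t ω : ℝ) := by positivity
    have hm := mul_le_mul_of_nonneg_left hdg hs0
    have hm2 := mul_le_mul_of_nonneg_left hN hs0
    rw [hcast, ageChange, abs_le]
    constructor <;> nlinarith

theorem IsRegular.abs_minAge_sub_le (hω : G.IsRegular ω) {s t : ℝ≥0} (hst : s ≤ t) :
    |G.minAge t ω - G.minAge s ω - G.minAgeChange s t ω| ≤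
      2 * ((1 + G.minAge s ω) * ((G.totalInc s t ω - 1 : ℕ) : ℝ)) := by
  have hs0 := hω.minAge_nonneg s
  rcases (by omega : G.totalInc s t ω = 0 ∨ G.totalInc s t ω = 1 ∨ 2 ≤ G.totalInc s t ω)
    with h | h | h
  · have hno := noEvent_of_sum_eq_zero (c := fun e r => G.count e r ω)
      (fun e => G.count_mono e ω) hst h
    simp only [minAgeChange, inc_eq_zero_of_noEvent hno, h]
    simp [minAge, maxNode, G.state_const ω s t hst hno]
  · obtain ⟨e, he⟩ := onlyEvent_of_sum_eq_one (c := fun e r => G.count e r ω)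
      (fun e => G.count_mono e ω) hst h
    have hz : G.minAge t ω - G.minAge s ω - G.minAgeChange s t ω = 0 := by
      simp only [minAgeChange, inc_eq_ite_of_onlyEvent he]
      have hst' := G.state_step ω s t e hst he
      rcases e with _ | k | ⟨l, k⟩
      · simp [minAge, maxNode, hst', Versions.step]
      · simp only [minAge, maxNode, hst',
          Versions.sup_step_deliver _ (fun i => hω.node_le_source s i)]
        simp [Versions.step]
      · simp only [minAge, maxNode, hst', Versions.sup_step_gossip]
        simp [Versions.step]
    rw [hz, h]; simp
  · have hcast : ((G.totalInc s t ω - 1 : ℕ) : ℝ) = (G.totalInc s t ω : ℝ) - 1 := by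
      rw [Nat.cast_sub (by omega), Nat.cast_one]
    have ht0 := hω.minAge_nonneg t
    have htle := hω.minAge_le hst
    have htot := totalInc_eq (G := G) (ω := ω) s t
    have hd : ∑ k, (G.inc (.deliver k) s t ω : ℝ) ≤ G.totalInc s t ω := by
      rw [← Nat.cast_sum]
      exact_mod_cast (by omega : ∑ k, G.inc (.deliver k) s t ω ≤ G.totalInc s t ω)
    have hν : (G.inc .refresh s t ω : ℝ) ≤ G.totalInc s t ω := by
      exact_mod_cast (by omega : G.inc .refresh s t ω ≤ G.totalInc s t ω)
    have hN : (2 : ℝ) ≤ G.totalInc s t ω := by exact_mod_cast h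
    have hd0 : 0 ≤ G.minAge s ω * ∑ k, (G.inc (.deliver k) s t ω : ℝ) :=
      mul_nonneg hs0 (Finset.sum_nonneg fun _ _ => Nat.cast_nonneg _)
    have hm := mul_le_mul_of_nonneg_left hd hs0
    have hm2 := mul_le_mul_of_nonneg_left hN hs0
    rw [hcast, minAgeChange, ← Finset.mul_sum, abs_le]
    constructor <;> nlinarith

theorem measurable_age_filtration (G : GossipNetwork P n lamE lam) (i : Fin n) (t : ℝ≥0) :
    Measurable[G.ℱ t] (G.age i t) :=
  Measurable.sub (measurable_from_nat.comp (G.state_adapted t).1)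
    (measurable_from_nat.comp ((G.state_adapted t).2 i))

theorem measurable_age (G : GossipNetwork P n lamE lam) (i : Fin n) (t : ℝ≥0) :
    Measurable (G.age i t) :=
  (G.measurable_age_filtration i t).mono (G.ℱ.le t) le_rfl

theorem measurable_minAge_filtration (G : GossipNetwork P n lamE lam) (t : ℝ≥0) :
    Measurable[G.ℱ t] (G.minAge t) := by
  have h : Measurable[G.ℱ t] (Finset.univ.sup fun i ω => (G.state t ω).node i) :=
    Finset.sup_induction (p := fun f : Ω → ℕ => Measurable[G.ℱ t] f) measurable_const
      (fun _ hf _ hg => Measurable.sup hf hg) fun i _ => (G.state_adapted t).2 i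
  have h' : Measurable[G.ℱ t] (G.maxNode t) := by
    convert! h using 1
    funext ω
    simp [maxNode, Finset.sup_apply]
  exact Measurable.sub (measurable_from_nat.comp (G.state_adapted t).1)
    (measurable_from_nat.comp h')

theorem measurable_gain_filtration (G : GossipNetwork P n lamE lam) (j i : Fin n) (t : ℝ≥0) :
    Measurable[G.ℱ t] (G.gain j i t) :=
  Measurable.max
    (Measurable.sub (G.measurable_age_filtration i t) (G.measurable_age_filtration j t))
    measurable_const

/-- The mean of the minimal age. -/
noncomputable def meanMinAge (G : GossipNetwork P n lamE lam) (t : ℝ≥0) : ℝ := ∫ ω, G.minAge t ω ∂P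

theorem meanMinAge_nonneg (t : ℝ≥0) : 0 ≤ G.meanMinAge t :=
  integral_nonneg_of_ae (G.ae_isRegular.mono fun _ h => h.minAge_nonneg t)

section Integrals

variable [IsProbabilityMeasure P]

theorem integral_refresh {s t : ℝ≥0} (hst : s ≤ t) :
    Integrable (fun ω => (G.inc .refresh s t ω : ℝ)) P ∧
      ∫ ω, (G.inc .refresh s t ω : ℝ) ∂P = (lamE : ℝ) * ((t : ℝ) - s) := by
  have := G.integral_mul_source none hst (W := fun _ => 1) measurable_const
    (Eventually.of_forall fun _ => zero_le_one) (integrable_const _)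
  simpa [sourceEvent, sourceRate] using this

theorem integrable_age (i : Fin n) (t : ℝ≥0) : Integrable (G.age i t) P := by
  refine Integrable.mono' ((G.init_integrable i).add
    (G.integral_refresh (zero_le : 0 ≤ t)).1) (G.measurable_age i t).aestronglyMeasurable ?_
  filter_upwards [G.ae_isRegular] with ω hω
  rw [Real.norm_eq_abs, abs_of_nonneg (hω.age_nonneg t i)]
  exact hω.age_le zero_le i

theorem integrable_minAge (i : Fin n) (t : ℝ≥0) : Integrable (G.minAge t) P := by
  refine Integrable.mono' (G.integrable_age i t)
    ((G.measurable_minAge_filtration t).mono (G.ℱ.le t) le_rfl).aestronglyMeasurable ?_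
  filter_upwards [G.ae_isRegular] with ω hω
  rw [Real.norm_eq_abs, abs_of_nonneg (hω.minAge_nonneg t)]
  exact minAge_le_age t i

theorem integrable_gain (j i : Fin n) (t : ℝ≥0) : Integrable (G.gain j i t) P := by
  refine Integrable.mono' (G.integrable_age i t)
    ((G.measurable_gain_filtration j i t).mono (G.ℱ.le t) le_rfl).aestronglyMeasurable ?_
  filter_upwards [G.ae_isRegular] with ω hω
  rw [Real.norm_eq_abs, abs_of_nonneg (gain_nonneg j i t)]
  exact hω.gain_le_age j i t

theorem meanMinAge_le_meanAge (i : Fin n) (t : ℝ≥0) : G.meanMinAge t ≤ G.meanAge i t :=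
  integral_mono (G.integrable_minAge i t) (G.integrable_age i t) fun _ => minAge_le_age t i

theorem meanAge_le (i : Fin n) (t : ℝ≥0) : G.meanAge i t ≤ G.meanAge i 0 + lamE * t := by
  have h := (G.integral_refresh (zero_le : 0 ≤ t))
  have h2 : ∫ ω, (G.age i 0 ω + G.inc .refresh 0 t ω) ∂P = G.meanAge i 0 + lamE * t := by
    rw [integral_add (G.integrable_age i 0) h.1, h.2]; simp [meanAge]
  rw [← h2]
  exact integral_mono_ae (G.integrable_age i t) ((G.integrable_age i 0).add h.1)
    (G.ae_isRegular.mono fun _ h => h.age_le zero_le i)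

/-- The weight `1 + X` belongs to the past of t, so the expected excess of events turns a pathwise
error into a mean error of order h². -/
theorem TotalRateLE.abs_integral_sub_le (hn : 2 ≤ n) (hG : G.TotalRateLE B) (t h : ℝ≥0)
    {X Y D : Ω → ℝ} (hXm : Measurable[G.ℱ t] X) (hX0 : 0 ≤ᵐ[P] X) (hX : Integrable X P)
    (hY : Integrable Y P) (hD : Integrable D P)
    (hbd : ∀ᵐ ω ∂P, |Y ω - X ω - D ω| ≤ 2 * ((1 + X ω) * ((G.totalInc t (t + h) ω - 1 : ℕ) : ℝ))) :
    |∫ ω, Y ω ∂P - ∫ ω, X ω ∂P - ∫ ω, D ω ∂P| ≤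
      2 * ((eventRateBound n lamE lam B : ℝ) * h) ^ 2 * (1 + ∫ ω, X ω ∂P) := by
  have hW := hG.integral_mul_totalInc_sub_one_le hn t h (W := fun ω => 1 + X ω)
    (Measurable.add measurable_const hXm)
    (by filter_upwards [hX0] with ω hω; exact add_nonneg zero_le_one hω)
    ((integrable_const 1).add hX)
  have hYX : Integrable (fun ω => Y ω - X ω) P := hY.sub hX
  rw [← integral_sub hY hX, ← integral_sub hYX hD]
  refine abs_integral_le_integral_abs.trans ?_
  refine (integral_mono_ae (hYX.sub hD).abs (hW.1.const_mul 2) hbd).trans ?_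
  rw [integral_const_mul, mul_assoc]
  refine (mul_le_mul_of_nonneg_left hW.2 zero_le_two).trans (le_of_eq ?_)
  rw [integral_add (integrable_const 1) hX]
  simp

/-- Substitute for the differential equation of the mean age. The gossip term stays an integrated
compensator, since the rates need not be continuous in time. -/
theorem TotalRateLE.abs_meanAge_sub_le (hn : 2 ≤ n) (hG : G.TotalRateLE B) (i : Fin n)
    (t h : ℝ≥0) :
    |G.meanAge i (t + h) - G.meanAge i t - ((lamE : ℝ) * h - (lam : ℝ) / n * h * G.meanAge i t -
      ∑ j, ∫ ω, G.gain j i t ω * G.compensator j i t (t + h) ω ∂P)| ≤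
      2 * ((eventRateBound n lamE lam B : ℝ) * h) ^ 2 * (1 + G.meanAge i t) := by
  have hth : t ≤ t + h := le_self_add
  have h1 := G.integral_refresh hth
  have h2 := G.integral_mul_source (some i) hth (G.measurable_age_filtration i t)
    (G.ae_isRegular.mono fun _ h => h.age_nonneg t i) (G.integrable_age i t)
  have h3 := fun j => hG.integral_mul_gossip hn j i hth (G.measurable_gain_filtration j i t)
    (Eventually.of_forall fun _ => gain_nonneg j i t) (G.integrable_gain j i t)
  simp only [sourceEvent, sourceRate] at h2
  have h12 : Integrable (fun ω => (G.inc .refresh t (t + h) ω : ℝ) -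
      G.age i t ω * G.inc (.deliver i) t (t + h) ω) P := h1.1.sub h2.1
  have hD : Integrable (G.ageChange i t (t + h)) P :=
    h12.sub (integrable_finsetSum _ fun j _ => (h3 j).1)
  have hDe : ∫ ω, G.ageChange i t (t + h) ω ∂P = (lamE : ℝ) * h - (lam : ℝ) / n * h * G.meanAge i t -
      ∑ j, ∫ ω, G.gain j i t ω * G.compensator j i t (t + h) ω ∂P := by
    simp only [ageChange]
    rw [integral_sub h12 (integrable_finsetSum _ fun j _ => (h3 j).1),
      integral_sub h1.1 h2.1, integral_finsetSum _ fun j _ => (h3 j).1, h1.2, h2.2]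
    simp only [(h3 _).2]
    simp [meanAge]
  rw [← hDe]
  exact hG.abs_integral_sub_le hn t h (G.measurable_age_filtration i t)
    (G.ae_isRegular.mono fun _ h => h.age_nonneg t i) (G.integrable_age i t)
    (G.integrable_age i _) hD (G.ae_isRegular.mono fun _ h => h.abs_age_sub_le i hth)

/-- The n delivery rates lam/n add up to lam, and gossip contributes nothing to the first-order
term. -/
theorem TotalRateLE.abs_meanMinAge_sub_le (hn : 2 ≤ n) (hG : G.TotalRateLE B) (t h : ℝ≥0) :
    |G.meanMinAge (t + h) - G.meanMinAge t - ((lamE : ℝ) * h - (lam : ℝ) * h * G.meanMinAge t)| ≤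
      2 * ((eventRateBound n lamE lam B : ℝ) * h) ^ 2 * (1 + G.meanMinAge t) := by
  have hth : t ≤ t + h := le_self_add
  have i : Fin n := ⟨0, by omega⟩
  have hn' : (n : ℝ) ≠ 0 := by positivity
  have h1 := G.integral_refresh hth
  have h2 := fun k => G.integral_mul_source (some k) hth (G.measurable_minAge_filtration t)
    (G.ae_isRegular.mono fun _ h => h.minAge_nonneg t) (G.integrable_minAge i t)
  simp only [sourceEvent, sourceRate] at h2
  have hD : Integrable (G.minAgeChange t (t + h)) P :=
    h1.1.sub (integrable_finsetSum _ fun j _ => (h2 j).1)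
  have hDe : ∫ ω, G.minAgeChange t (t + h) ω ∂P =
      (lamE : ℝ) * h - (lam : ℝ) * h * G.meanMinAge t := by
    simp only [minAgeChange]
    rw [integral_sub h1.1 (integrable_finsetSum _ fun j _ => (h2 j).1),
      integral_finsetSum _ fun j _ => (h2 j).1, h1.2]
    simp only [(h2 _).2]
    simp [meanMinAge]
    field_simp
  rw [← hDe]
  exact hG.abs_integral_sub_le hn t h (G.measurable_minAge_filtration t)
    (G.ae_isRegular.mono fun _ h => h.minAge_nonneg t) (G.integrable_minAge i t)
    (G.integrable_minAge i _) hD (G.ae_isRegular.mono fun _ h => h.abs_minAge_sub_le hth)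

end Integrals

end GossipNetwork

/-! ### Asymptotics of difference inequalities. -/

section Recursion

theorem eventually_le_of_contraction {w : ℝ≥0 → ℝ} {h T : ℝ≥0} {q K : ℝ} (hh : 0 < h) (hq : 0 ≤ q)
    (hq1 : q < 1) (hw : ∀ t, T ≤ t → w (t + h) ≤ q * w t)
    (hK : ∀ t, T ≤ t → t ≤ T + h → w t ≤ K) {ε : ℝ} (hε : 0 < ε) : ∀ᶠ t in atTop, w t ≤ ε := by
  have iter : ∀ (k : ℕ) t, T ≤ t → w (t + k * h) ≤ q ^ k * w t := by
    intro k
    induction k with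
    | zero => intro t _; simp
    | succ k ih =>
      intro t ht
      have := hw (t + k * h) (ht.trans le_self_add)
      have e : t + ((k + 1 : ℕ) : ℝ≥0) * h = t + k * h + h := by push_cast; ring
      rw [e, pow_succ', mul_assoc]
      exact this.trans (mul_le_mul_of_nonneg_left (ih t ht) hq)
  have hlim : Tendsto (fun k : ℕ => q ^ k * |K|) atTop (𝓝 0) := by
    simpa using (tendsto_pow_atTop_nhds_zero_of_lt_one hq hq1).mul_const |K|
  obtain ⟨k₀, hk₀⟩ := eventually_atTop.1 (hlim.eventually (gt_mem_nhds hε))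
  filter_upwards [eventually_ge_atTop (T + k₀ * h)] with t ht
  have hTt : T ≤ t := le_self_add.trans ht
  -- Going back k whole steps from t leads into the window [T, T + h], where K bounds w.
  set k := ⌊(t - T) / h⌋₊
  have hk1 : (k : ℝ≥0) * h ≤ t - T := by
    have := Nat.floor_le (zero_le : 0 ≤ (t - T) / h)
    rwa [le_div_iff₀ hh] at this
  have hk2 : t - T ≤ ((k : ℝ≥0) + 1) * h := by
    have := (Nat.lt_floor_add_one ((t - T) / h)).le
    rwa [div_le_iff₀ hh] at this
  have hk3 : k₀ ≤ k := by
    refine Nat.le_floor ?_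
    rw [le_div_iff₀ hh]
    exact le_tsub_of_add_le_left ht
  obtain ⟨u, hu⟩ := exists_add_of_le hk1
  have htu : t = T + u + k * h := by
    rw [← add_tsub_cancel_of_le hTt, hu]; ring
  have hub : u ≤ h := by
    rw [hu, add_mul, one_mul] at hk2
    exact le_of_add_le_add_left hk2
  rw [htu]
  calc _ ≤ q ^ k * w (T + u) := iter k _ le_self_add
    _ ≤ q ^ k * |K| := by
      gcongr
      exact (hK _ le_self_add (by gcongr)).trans (le_abs_self K)
    _ ≤ ε := (hk₀ k hk3).le

/-- For fixed small h, let z be the fixed point of the recursion with b replaced by b₀ - h, a lower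
bound for late b. Then z - f contracts with ratio 1 - (α + C h) h, and z tends to b₀/α with h. No
regularity of f in time is needed. -/
theorem eventually_ge_of_recursion {f b : ℝ≥0 → ℝ} {α b₀ C : ℝ} (hα : 0 < α) (hC : 0 ≤ C)
    (hf : ∀ t, 0 ≤ f t) (hb : Tendsto b atTop (𝓝 b₀))
    (hrec : ∀ t h : ℝ≥0, f t + h * (b t - α * f t) - C * (h : ℝ) ^ 2 * (1 + f t) ≤ f (t + h))
    {ε : ℝ} (hε : 0 < ε) : ∀ᶠ t in atTop, b₀ / α - ε ≤ f t := by
  have hz : Tendsto (fun h : ℝ => (b₀ - h - C * h) / (α + C * h)) (𝓝[>] 0) (𝓝 (b₀ / α)) := by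
    have : ContinuousAt (fun h : ℝ => (b₀ - h - C * h) / (α + C * h)) 0 :=
      ContinuousAt.div (by fun_prop) (by fun_prop) (by simpa using hα.ne')
    simpa using this.tendsto.mono_left nhdsWithin_le_nhds
  have hq : Tendsto (fun h : ℝ => (α + C * h) * h) (𝓝[>] 0) (𝓝 0) := by
    have : Continuous fun h : ℝ => (α + C * h) * h := by fun_prop
    simpa using (this.tendsto 0).mono_left nhdsWithin_le_nhds
  obtain ⟨h, ⟨hz', hq'⟩, hh⟩ := ((hz.eventually (lt_mem_nhds (by linarith : b₀ / α - ε / 2 < b₀ / α))).and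
    (hq.eventually (gt_mem_nhds one_pos))).and self_mem_nhdsWithin |>.exists
  have hh : 0 < h := hh
  lift h to ℝ≥0 using hh.le
  obtain ⟨T, hT⟩ := eventually_atTop.1 (hb.eventually (lt_mem_nhds (by linarith : b₀ - h < b₀)))
  set z := (b₀ - h - C * h) / (α + C * h)
  have hαC : 0 < α + C * h := by positivity
  have hzm : z * (α + C * h) = b₀ - h - C * h := div_mul_cancel₀ _ hαC.ne'
  have := eventually_le_of_contraction (w := fun t => z - f t) (h := h) (T := T)
    (q := 1 - (α + C * h) * h) (K := z) (by exact_mod_cast hh) (by linarith)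
    (by nlinarith) ?_ ?_ (half_pos hε)
  · filter_upwards [this] with t ht
    linarith
  · intro t ht
    have h1 := hrec t h
    have h2 := mul_le_mul_of_nonneg_left (hT t ht).le hh.le
    have h3 : z * (α + C * h) * h = (b₀ - h - C * h) * h := by rw [hzm]
    nlinarith
  · intro t _ _
    linarith [hf t]

/-- Mirror image, with fixed point (b₀ + h + C h)/(α - C h), so h must also make α - C h positive.
The linear growth bound controls f on the starting window, as nonnegativity does for the lower
estimate. -/
theorem eventually_le_of_recursion {f b : ℝ≥0 → ℝ} {α b₀ C a c : ℝ} (hα : 0 < α)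
    (hc : 0 ≤ c) (hf : ∀ t, f t ≤ a + c * t) (hb : Tendsto b atTop (𝓝 b₀))
    (hrec : ∀ t h : ℝ≥0, f (t + h) ≤ f t + h * (b t - α * f t) + C * (h : ℝ) ^ 2 * (1 + f t))
    {ε : ℝ} (hε : 0 < ε) : ∀ᶠ t in atTop, f t ≤ b₀ / α + ε := by
  have hz : Tendsto (fun h : ℝ => (b₀ + h + C * h) / (α - C * h)) (𝓝[>] 0) (𝓝 (b₀ / α)) := by
    have : ContinuousAt (fun h : ℝ => (b₀ + h + C * h) / (α - C * h)) 0 :=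
      ContinuousAt.div (by fun_prop) (by fun_prop) (by simpa using hα.ne')
    simpa using this.tendsto.mono_left nhdsWithin_le_nhds
  have hq : Tendsto (fun h : ℝ => (α - C * h) * h) (𝓝[>] 0) (𝓝 0) := by
    have : Continuous fun h : ℝ => (α - C * h) * h := by fun_prop
    simpa using (this.tendsto 0).mono_left nhdsWithin_le_nhds
  have hp : Tendsto (fun h : ℝ => α - C * h) (𝓝[>] 0) (𝓝 α) := by
    have : Continuous fun h : ℝ => α - C * h := by fun_prop
    simpa using (this.tendsto 0).mono_left nhdsWithin_le_nhds
  obtain ⟨h, ⟨⟨hz', hq'⟩, hαC⟩, hh⟩ :=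
    (((hz.eventually (gt_mem_nhds (by linarith : b₀ / α < b₀ / α + ε / 2))).and
    (hq.eventually (gt_mem_nhds one_pos))).and (hp.eventually (lt_mem_nhds hα))).and
    self_mem_nhdsWithin |>.exists
  have hh : 0 < h := hh
  lift h to ℝ≥0 using hh.le
  obtain ⟨T, hT⟩ := eventually_atTop.1 (hb.eventually (gt_mem_nhds (by linarith : b₀ < b₀ + h)))
  set z := (b₀ + h + C * h) / (α - C * h)
  have hzm : z * (α - C * h) = b₀ + h + C * h := div_mul_cancel₀ _ hαC.ne'
  have := eventually_le_of_contraction (w := fun t => f t - z) (h := h) (T := T)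
    (q := 1 - (α - C * h) * h) (K := a + c * (T + h) - z) (by exact_mod_cast hh) (by linarith)
    (by nlinarith) ?_ ?_ (half_pos hε)
  · filter_upwards [this] with t ht
    linarith
  · intro t ht
    have h1 := hrec t h
    have h2 := mul_le_mul_of_nonneg_left (hT t ht).le hh.le
    have h3 : z * (α - C * h) * h = (b₀ + h + C * h) * h := by rw [hzm]
    nlinarith
  · intro t _ ht
    have h1 := hf t
    have h2 : (t : ℝ) ≤ T + h := by exact_mod_cast ht
    have := mul_le_mul_of_nonneg_left h2 hc
    linarith

end Recursion

/-! ### The lower bound for arbitrary policies. -/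

namespace GossipNetwork

variable {Ω : Type*} [MeasurableSpace Ω] {P : Measure Ω} {n : ℕ} {lamE lam : ℝ≥0}
  {G : GossipNetwork P n lamE lam} {B : ℝ≥0} {ω : Ω}

section Bounds

variable [IsProbabilityMeasure P]

theorem TotalRateLE.tendsto_meanMinAge (hn : 2 ≤ n) (hlam : 0 < lam) (hG : G.TotalRateLE B) :
    Tendsto G.meanMinAge atTop (𝓝 ((lamE : ℝ) / lam)) := by
  have i : Fin n := ⟨0, by omega⟩
  set γ := eventRateBound n lamE lam B
  have hrec := fun t h => abs_le.1 (hG.abs_meanMinAge_sub_le hn t h)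
  have hC : (0 : ℝ) ≤ 2 * (γ : ℝ) ^ 2 := by positivity
  have hlo := fun ε (hε : 0 < ε) => eventually_ge_of_recursion (f := G.meanMinAge)
    (b := fun _ => (lamE : ℝ)) (α := lam) (C := 2 * (γ : ℝ) ^ 2) (by exact_mod_cast hlam) hC
    meanMinAge_nonneg tendsto_const_nhds (fun t h => by nlinarith [(hrec t h).1]) hε
  have hup := fun ε (hε : 0 < ε) => eventually_le_of_recursion (f := G.meanMinAge)
    (b := fun _ => (lamE : ℝ)) (α := lam) (C := 2 * (γ : ℝ) ^ 2) (a := G.meanAge i 0) (c := lamE)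
    (by exact_mod_cast hlam) (NNReal.coe_nonneg _)
    (fun t => (meanMinAge_le_meanAge i t).trans (meanAge_le i t))
    tendsto_const_nhds (fun t h => by nlinarith [(hrec t h).2]) hε
  rw [Metric.tendsto_nhds]
  intro ε hε
  filter_upwards [hlo (ε / 2) (half_pos hε), hup (ε / 2) (half_pos hε)] with t h1 h2
  rw [Real.dist_eq, abs_lt]
  constructor <;> linarith

/-- The decisive estimate for the lower bound: no sender helps i more than one with the freshest
version, and the senders share the budget. -/
theorem TotalRateLE.sum_integral_gain_le (hn : 2 ≤ n) (hG : G.TotalRateLE B) (i : Fin n)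
    (t h : ℝ≥0) : ∑ j, ∫ ω, G.gain j i t ω * G.compensator j i t (t + h) ω ∂P ≤
      (B : ℝ) / ((n : ℝ) - 1) * h * (G.meanAge i t - G.meanMinAge t) := by
  have hth : t ≤ t + h := le_self_add
  have hi := fun j => hG.integrable_mul_compensator hn j i hth (G.integrable_gain j i t)
  rw [← integral_finsetSum _ fun j _ => hi j, meanAge, meanMinAge,
    ← integral_sub (G.integrable_age i t) (G.integrable_minAge i t), ← integral_const_mul]
  refine integral_mono (integrable_finsetSum _ fun j _ => hi j)
    (((G.integrable_age i t).sub (G.integrable_minAge i t)).const_mul _) fun ω => ?_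
  have hc := hG.sum_compensator_le hn i hth ω
  have hd : 0 ≤ G.age i t ω - G.minAge t ω := sub_nonneg.2 (minAge_le_age t i)
  calc ∑ j, G.gain j i t ω * G.compensator j i t (t + h) ω
      ≤ ∑ j, (G.age i t ω - G.minAge t ω) * G.compensator j i t (t + h) ω :=
        Finset.sum_le_sum fun j _ =>
          mul_le_mul_of_nonneg_right (gain_le j i t) (compensator_nonneg hn j i hth ω)
    _ = (G.age i t ω - G.minAge t ω) * ∑ j, G.compensator j i t (t + h) ω := by
        rw [Finset.mul_sum]
    _ ≤ (G.age i t ω - G.minAge t ω) * (B / ((n : ℝ) - 1) * h) := by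
        refine mul_le_mul_of_nonneg_left ?_ hd
        simpa using hc
    _ = _ := mul_comm _ _

theorem meanAge_nonneg (i : Fin n) (t : ℝ≥0) : 0 ≤ G.meanAge i t :=
  (meanMinAge_nonneg t).trans (meanMinAge_le_meanAge i t)

/-- Every policy of total rate at most `B` obeys the lower bound up to any `ε`. -/
theorem TotalRateLE.eventually_ge (hn : 2 ≤ n) (hlam : 0 < lam) (hG : G.TotalRateLE B)
    (i : Fin n) {ε : ℝ} (hε : 0 < ε) :
    ∀ᶠ t in atTop, optimalAge n lamE lam B - ε ≤ G.meanAge i t := by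
  have hn' : (2 : ℝ) ≤ n := by exact_mod_cast hn
  have hl : (0 : ℝ) < lam := by exact_mod_cast hlam
  set γ := eventRateBound n lamE lam B
  have hβ : 0 ≤ (B : ℝ) / ((n : ℝ) - 1) := div_nonneg B.2 (by linarith)
  have hα : 0 < (lam : ℝ) / n + (B : ℝ) / ((n : ℝ) - 1) := by positivity
  -- In the limit, `b` is the numerator of `optimalAge`; its denominator is α.
  refine eventually_ge_of_recursion (f := G.meanAge i) (C := 2 * (γ : ℝ) ^ 2)
    (b := fun t => (lamE : ℝ) + (B : ℝ) / ((n : ℝ) - 1) * G.meanMinAge t) hα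
    (by positivity) (meanAge_nonneg i)
    (((hG.tendsto_meanMinAge hn hlam).const_mul _).const_add _) (fun t h => ?_) hε
  have h1 := (abs_le.1 (hG.abs_meanAge_sub_le hn i t h)).1
  have h2 := hG.sum_integral_gain_le hn i t h
  nlinarith

theorem TotalRateLE.optimalAge_le (hn : 2 ≤ n) (hlam : 0 < lam) (hG : G.TotalRateLE B)
    (i : Fin n) {a : ℝ} (ha : G.HasSteadyStateMeanAge i a) : optimalAge n lamE lam B ≤ a :=
  le_of_forall_pos_le_add fun _ hε =>
    sub_le_iff_le_add.1 (ge_of_tendsto ha (hG.eventually_ge hn hlam i hε))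

/-- In `EReal` the liminf is meaningful without a bound on the mean ages. -/
theorem TotalRateLE.optimalAge_le_liminf (hn : 2 ≤ n) (hlam : 0 < lam) (hG : G.TotalRateLE B)
    (i : Fin n) : ((optimalAge n lamE lam B : ℝ) : EReal) ≤
      liminf (fun t => ((G.meanAge i t : ℝ) : EReal)) atTop := by
  refine le_of_forall_lt fun c hc => ?_
  obtain ⟨x, hcx, hx⟩ := EReal.lt_iff_exists_real_btwn.1 hc
  have hx : x < optimalAge n lamE lam B := by exact_mod_cast hx
  refine hcx.trans_le (le_liminf_of_le (by isBoundedDefault) ?_)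
  filter_upwards [hG.eventually_ge hn hlam i (sub_pos.2 hx)] with t ht
  exact_mod_cast (by linarith : x ≤ G.meanAge i t)

end Bounds

/-! ### The semi-distributed scheme attains the bound. -/

section SemiDistributed

theorem IsSemiDistributed.totalRateLE (hS : G.IsSemiDistributed B) : G.TotalRateLE B := by
  intro t ω
  by_cases hj : ∃ j, G.IsLastUpdated j t ω
  · obtain ⟨j, hj⟩ := hj
    rw [Finset.sum_eq_single j]
    · rw [hS, if_pos hj]
    · intro k _ hk
      rw [hS, if_neg fun hk' => hk (isLastUpdated_unique hk' hj)]
    · simp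
  · push Not at hj
    rw [Finset.sum_eq_zero fun j _ => by rw [hS, if_neg (hj j)]]
    exact B.2

/-- The rate of the last updated node stays B until the next delivery; if one falls in the interval,
the left side is at most 0. Only the rate at t and later source increments remain on the left, so
its mean is computable. -/
theorem IsSemiDistributed.compensator_ge (hn : 2 ≤ n) (hS : G.IsSemiDistributed B) {j i : Fin n}
    (hji : j ≠ i) (t h : ℝ≥0) (ω : Ω) :
    h / ((n : ℝ) - 1) * (G.rate j t ω * (1 - ∑ k, (G.inc (.deliver k) t (t + h) ω : ℝ))) ≤
      G.compensator j i t (t + h) ω := by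
  have hn' : (2 : ℝ) ≤ n := by exact_mod_cast hn
  have hth : t ≤ t + h := le_self_add
  have hc := compensator_nonneg (G := G) hn j i hth ω
  have hh : 0 ≤ (h : ℝ) / ((n : ℝ) - 1) := div_nonneg h.2 (by linarith)
  by_cases hj : G.IsLastUpdated j t ω
  · by_cases hd : ∑ k, G.inc (.deliver k) t (t + h) ω = 0
    · have hcount : ∀ u, t ≤ u → u ≤ t + h → ∀ k,
          G.count (.deliver k) u ω = G.count (.deliver k) t ω := by
        intro u htu huh k
        have h0 := Finset.sum_eq_zero_iff.1 hd k (Finset.mem_univ k)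
        have h1 := G.count_mono (.deliver k) ω htu
        have h2 := G.count_mono (.deliver k) ω huh
        simp only [inc] at h0 h1 h2
        omega
      have heq : G.compensator j i t (t + h) ω = ∫ x in (t : ℝ)..(t + h : ℝ≥0),
          (B : ℝ) / ((n : ℝ) - 1) := by
        refine intervalIntegral.integral_congr fun x hx => ?_
        rw [Set.uIcc_of_le (NNReal.coe_le_coe.2 hth)] at hx
        have h1 : t ≤ x.toNNReal := NNReal.le_toNNReal_of_coe_le hx.1
        have h2 : x.toNNReal ≤ t + h := Real.toNNReal_le_iff_le_coe.2 hx.2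
        simp only [gossipRate, if_neg hji]
        rw [hS, if_pos (hj.persist h1 (hcount _ h1 h2))]
      rw [heq, intervalIntegral.integral_const, hS, if_pos hj, ← Nat.cast_sum, hd]
      simp only [smul_eq_mul, NNReal.coe_add]
      refine le_of_eq ?_
      push_cast
      ring
    · have : (1 : ℝ) ≤ ∑ k, (G.inc (.deliver k) t (t + h) ω : ℝ) := by
        rw [← Nat.cast_sum]
        exact_mod_cast Nat.one_le_iff_ne_zero.2 hd
      refine le_trans ?_ hc
      exact mul_nonpos_of_nonneg_of_nonpos hh
        (mul_nonpos_of_nonneg_of_nonpos (G.rate_nonneg j t ω) (by linarith))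
  · rw [hS, if_neg hj]
    simpa using hc

/-- The part of the age of node `i` on the event that the source has not transmitted to it. -/
noncomputable def untouchedAge (G : GossipNetwork P n lamE lam) (i : Fin n) (t : ℝ≥0) (ω : Ω) : ℝ :=
  G.age i t ω * Set.indicator {0} 1 (G.inc (.deliver i) 0 t ω)

/-- After the first transmission, the last updated node has the smallest age and rate B, and its
term alone suffices. Before it, the untouched age cancels the age of i. The correction uses the
event that i itself was not served: a larger event than needed, but governed by one Poisson
variable. -/
theorem IsSemiDistributed.age_sub_le (hS : G.IsSemiDistributed B) (hω : G.IsRegular ω) (i : Fin n)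
    (t : ℝ≥0) : B * (G.age i t ω - G.minAge t ω - G.untouchedAge i t ω) ≤
      ∑ j, G.gain j i t ω * G.rate j t ω := by
  have hsum : 0 ≤ ∑ j, G.gain j i t ω * G.rate j t ω :=
    Finset.sum_nonneg fun j _ => mul_nonneg (gain_nonneg j i t) (G.rate_nonneg j t ω)
  have hB := NNReal.coe_nonneg B
  have hm0 := hω.minAge_nonneg t
  rcases hω.exists_isLastUpdated t with h | ⟨j, hj, hmax⟩
  · have : G.inc (.deliver i) 0 t ω = 0 := by simp [inc, h i]
    refine le_trans ?_ hsum
    simp only [untouchedAge, this]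
    simp only [Set.mem_singleton_iff, Set.indicator_of_mem, Pi.one_apply, mul_one]
    nlinarith
  · have hu : 0 ≤ G.untouchedAge i t ω :=
      mul_nonneg (hω.age_nonneg t i) (Set.indicator_nonneg (fun _ _ => zero_le_one) _)
    have hmin : G.minAge t ω = G.age j t ω := by
      have : G.maxNode t ω = (G.state t ω).node j :=
        le_antisymm (Finset.sup_le fun k _ => hmax k) (node_le_maxNode t j)
      simp [minAge, age, Versions.age, this]
    have hgain : G.age i t ω - G.age j t ω ≤ G.gain j i t ω := le_max_left _ _
    have hrate : G.rate j t ω = B := by rw [hS, if_pos hj]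
    refine le_trans ?_ (Finset.single_le_sum (f := fun j => G.gain j i t ω * G.rate j t ω)
      (fun j _ => mul_nonneg (gain_nonneg j i t) (G.rate_nonneg j t ω)) (Finset.mem_univ j))
    simp only [hrate, hmin]
    nlinarith

theorem measurable_indicator_inc (i : Fin n) (t : ℝ≥0) : Measurable fun ω =>
    (Set.indicator {0} 1 (G.inc (.deliver i) 0 t ω) : ℝ) :=
  Measurable.comp (g := fun k : ℕ => (Set.indicator {0} 1 k : ℝ)) measurable_from_nat
    (G.measurable_inc _ 0 t)

theorem integral_indicator_inc (i : Fin n) (t : ℝ≥0) :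
    ∫ ω, (Set.indicator {0} 1 (G.inc (.deliver i) 0 t ω) : ℝ) ∂P =
      Real.exp (-((lam : ℝ) / n * t)) := by
  have h := (G.source_law (some i) 0 t zero_le).integral_comp
    (f := fun k : ℕ => (Set.indicator {0} 1 k : ℝ)) measurable_from_nat.aestronglyMeasurable
  refine Eq.trans h ?_
  rw [integral_indicator_one (measurableSet_singleton 0), poissonMeasure_real_singleton]
  simp [sourceRate]

variable [IsProbabilityMeasure P]

theorem integrable_untouchedAge (i : Fin n) (t : ℝ≥0) : Integrable (G.untouchedAge i t) P := by
  refine (G.integrable_age i t).mul_bdd (c := 1)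
    (measurable_indicator_inc i t).aestronglyMeasurable (Eventually.of_forall fun ω => ?_)
  by_cases h : G.inc (.deliver i) 0 t ω = 0 <;> simp [h]

/-- The initial age and the number of refreshes are each independent of the deliveries to i, whose
absence has probability exp(-lam t/n). -/
theorem integral_untouchedAge_le (i : Fin n) (t : ℝ≥0) :
    ∫ ω, G.untouchedAge i t ω ∂P ≤
      (G.meanAge i 0 + lamE * t) * Real.exp (-((lam : ℝ) / n * t)) := by
  set Z : Ω → ℝ := fun ω => Set.indicator {0} 1 (G.inc (.deliver i) 0 t ω)
  have hZm : Measurable Z := measurable_indicator_inc i t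
  have hZ0 : ∀ ω, 0 ≤ Z ω := fun ω => Set.indicator_nonneg (fun _ _ => zero_le_one) _
  have hZb : ∀ ω, ‖Z ω‖ ≤ 1 := fun ω => by
    by_cases h : G.inc (.deliver i) 0 t ω = 0 <;> simp [Z, h]
  have hr := G.integral_refresh (zero_le : 0 ≤ t)
  have hi1 : Integrable (fun ω => G.age i 0 ω * Z ω) P :=
    (G.integrable_age i 0).mul_bdd hZm.aestronglyMeasurable (Eventually.of_forall hZb)
  have hi2 : Integrable (fun ω => (G.inc .refresh 0 t ω : ℝ) * Z ω) P :=
    hr.1.mul_bdd hZm.aestronglyMeasurable (Eventually.of_forall hZb)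
  have ind1 : IndepFun (G.age i 0) Z P := by
    have h := (G.source_indep_past 0 t zero_le).symm
    refine indep_of_indep_of_le_right (indep_of_indep_of_le_left h
      (G.measurable_age_filtration i 0).comap_le) ?_
    refine Measurable.comap_le ?_
    exact Measurable.comp (g := fun v : Option (Fin n) → ℕ => (Set.indicator {0} 1 (v (some i)) : ℝ))
      (Measurable.comp (g := fun k : ℕ => (Set.indicator {0} 1 k : ℝ)) measurable_from_nat
        (measurable_pi_apply (some i))) (comap_measurable _)
  have ind2 : IndepFun (fun ω => (G.inc .refresh 0 t ω : ℝ)) Z P := by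
    have h := (G.source_iIndep 0 t zero_le).indepFun (i := none) (j := some i) (by simp)
    exact h.comp (φ := fun k : ℕ => (k : ℝ)) (ψ := fun k : ℕ => (Set.indicator {0} 1 k : ℝ))
      measurable_from_nat measurable_from_nat
  calc ∫ ω, G.untouchedAge i t ω ∂P
      ≤ ∫ ω, (G.age i 0 ω * Z ω + (G.inc .refresh 0 t ω : ℝ) * Z ω) ∂P := by
        refine integral_mono_ae (integrable_untouchedAge i t) (hi1.add hi2) ?_
        filter_upwards [G.ae_isRegular] with ω hω
        rw [← add_mul]
        exact mul_le_mul_of_nonneg_right (hω.age_le zero_le i) (hZ0 ω)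
    _ = _ := by
        rw [integral_add hi1 hi2,
          ind1.integral_fun_mul_eq_mul_integral (G.integrable_age i 0).1 hZm.aestronglyMeasurable,
          ind2.integral_fun_mul_eq_mul_integral hr.1.1 hZm.aestronglyMeasurable, hr.2,
          integral_indicator_inc i t]
        simp only [meanAge, NNReal.coe_zero, sub_zero]
        ring

theorem tendsto_integral_untouchedAge (hn : 2 ≤ n) (hlam : 0 < lam) (i : Fin n) :
    Tendsto (fun t => ∫ ω, G.untouchedAge i t ω ∂P) atTop (𝓝 0) := by
  have hn' : (0 : ℝ) < n := by positivity
  have hl : (0 : ℝ) < lam := by exact_mod_cast hlam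
  have hr : 0 < (lam : ℝ) / n := by positivity
  have hlim : Tendsto (fun x : ℝ => (G.meanAge i 0 + lamE * x) * Real.exp (-((lam : ℝ) / n * x)))
      atTop (𝓝 0) := by
    have h1 := Real.tendsto_pow_mul_exp_neg_atTop_nhds_zero 1
    have h0 := Real.tendsto_pow_mul_exp_neg_atTop_nhds_zero 0
    have hx : Tendsto (fun x : ℝ => (lam : ℝ) / n * x) atTop atTop :=
      tendsto_id.const_mul_atTop hr
    have := ((h0.comp hx).const_mul (G.meanAge i 0)).add
      ((h1.comp hx).const_mul ((lamE : ℝ) / ((lam : ℝ) / n)))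
    simp only [mul_zero, add_zero] at this
    refine this.congr fun x => ?_
    simp only [Function.comp, pow_zero, pow_one]
    field_simp
  have hcoe : Tendsto (fun t : ℝ≥0 => (t : ℝ)) atTop atTop := NNReal.tendsto_coe_atTop.2 tendsto_id
  refine squeeze_zero (fun t => ?_) (fun t => integral_untouchedAge_le i t) (hlim.comp hcoe)
  refine integral_nonneg_of_ae ?_
  filter_upwards [G.ae_isRegular] with ω hω
  exact mul_nonneg (hω.age_nonneg t i) (Set.indicator_nonneg (fun _ _ => zero_le_one) _)

/-- V is the sum of gains weighted by the rates at t. Deliveries inside the interval cost the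
fraction lam h of its mean, and since V ≤ B · age, this loss is of second order. -/
theorem IsSemiDistributed.sum_integral_gain_ge (hn : 2 ≤ n) (hS : G.IsSemiDistributed B)
    (i : Fin n) (t h : ℝ≥0) :
    (B : ℝ) / ((n : ℝ) - 1) * h * (G.meanAge i t - G.meanMinAge t - ∫ ω, G.untouchedAge i t ω ∂P -
      lam * h * G.meanAge i t) ≤
    ∑ j, ∫ ω, G.gain j i t ω * G.compensator j i t (t + h) ω ∂P := by
  have hG := hS.totalRateLE
  have hn' : (2 : ℝ) ≤ n := by exact_mod_cast hn
  have hn0 : (n : ℝ) ≠ 0 := by positivity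
  have hth : t ≤ t + h := le_self_add
  have hc : 0 ≤ (h : ℝ) / ((n : ℝ) - 1) := div_nonneg h.2 (by linarith)
  have hrm : ∀ j, Measurable[G.ℱ t] (G.rate j t) := fun j =>
    ((G.rate_progressive j).stronglyAdapted t).measurable
  have hVm : ∀ j, Measurable[G.ℱ t] fun ω => G.gain j i t ω * G.rate j t ω := fun j =>
    Measurable.mul (G.measurable_gain_filtration j i t) (hrm j)
  have hVi : ∀ j, Integrable (fun ω => G.gain j i t ω * G.rate j t ω) P := fun j => by
    refine (G.integrable_gain j i t).mul_bdd (c := B)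
      ((hrm j).mono (G.ℱ.le t) le_rfl).aestronglyMeasurable (Eventually.of_forall fun ω => ?_)
    rw [Real.norm_eq_abs, abs_of_nonneg (G.rate_nonneg j t ω)]
    exact hG.rate_le j t ω
  let V : Ω → ℝ := fun ω => ∑ j, G.gain j i t ω * G.rate j t ω
  have hVm' : Measurable[G.ℱ t] V := Finset.measurable_sum _ fun j _ => hVm j
  have hVi' : Integrable V P := integrable_finsetSum _ fun j _ => hVi j
  have hV0 : ∀ ω, 0 ≤ V ω := fun ω => Finset.sum_nonneg fun j _ =>
    mul_nonneg (gain_nonneg j i t) (G.rate_nonneg j t ω)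
  have hd := fun k => G.integral_mul_source (some k) hth hVm' (Eventually.of_forall hV0) hVi'
  simp only [sourceEvent, sourceRate] at hd
  have hdi : Integrable (fun ω => ∑ k, V ω * (G.inc (.deliver k) t (t + h) ω : ℝ)) P :=
    integrable_finsetSum _ fun k _ => (hd k).1
  have hgi := fun j => hG.integrable_mul_compensator hn j i hth (G.integrable_gain j i t)
  have hlow : B * (G.meanAge i t - G.meanMinAge t - ∫ ω, G.untouchedAge i t ω ∂P) ≤
      ∫ ω, V ω ∂P := by
    have hsub : Integrable (fun ω => G.age i t ω - G.minAge t ω) P :=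
      (G.integrable_age i t).sub (G.integrable_minAge i t)
    rw [meanAge, meanMinAge, ← integral_sub (G.integrable_age i t) (G.integrable_minAge i t),
      ← integral_sub hsub (integrable_untouchedAge i t), ← integral_const_mul]
    exact integral_mono_ae ((hsub.sub (integrable_untouchedAge i t)).const_mul _) hVi'
      (G.ae_isRegular.mono fun ω hω => hS.age_sub_le hω i t)
  have hupp : ∫ ω, V ω ∂P ≤ B * G.meanAge i t := by
    rw [meanAge, ← integral_const_mul]
    refine integral_mono_ae hVi' ((G.integrable_age i t).const_mul _) ?_
    filter_upwards [G.ae_isRegular] with ω hω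
    calc V ω ≤ ∑ j, G.age i t ω * G.rate j t ω := Finset.sum_le_sum fun j _ =>
          mul_le_mul_of_nonneg_right (hω.gain_le_age j i t) (G.rate_nonneg j t ω)
      _ = (∑ j, G.rate j t ω) * G.age i t ω := by rw [← Finset.mul_sum, mul_comm]
      _ ≤ B * G.age i t ω := mul_le_mul_of_nonneg_right (hG t ω) (hω.age_nonneg t i)
  have hmain : h / ((n : ℝ) - 1) * (∫ ω, V ω ∂P - lam * h * ∫ ω, V ω ∂P) ≤
      ∑ j, ∫ ω, G.gain j i t ω * G.compensator j i t (t + h) ω ∂P := by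
    have e : ∫ ω, (V ω - ∑ k, V ω * (G.inc (.deliver k) t (t + h) ω : ℝ)) ∂P =
        ∫ ω, V ω ∂P - lam * h * ∫ ω, V ω ∂P := by
      rw [integral_sub hVi' hdi, integral_finsetSum _ fun k _ => (hd k).1]
      simp only [(hd _).2]
      simp
      field_simp
    rw [← e, ← integral_finsetSum _ fun j _ => hgi j, ← integral_const_mul]
    refine integral_mono ((hVi'.sub hdi).const_mul _) (integrable_finsetSum _ fun j _ => hgi j)
      fun ω => ?_
    have : h / ((n : ℝ) - 1) * (V ω - ∑ k, V ω * (G.inc (.deliver k) t (t + h) ω : ℝ)) =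
        ∑ j, G.gain j i t ω * (h / ((n : ℝ) - 1) * (G.rate j t ω *
          (1 - ∑ k, (G.inc (.deliver k) t (t + h) ω : ℝ)))) := by
      rw [← Finset.mul_sum, ← mul_one_sub]
      simp only [V, Finset.sum_mul, Finset.mul_sum]
      exact Finset.sum_congr rfl fun j _ => by ring
    dsimp only
    rw [this]
    refine Finset.sum_le_sum fun j _ => ?_
    -- Self-gossip has no intensity, so `compensator_ge` excludes it, but its gain is zero as well.
    by_cases hji : j = i
    · subst hji; simp [gain]
    · exact mul_le_mul_of_nonneg_left (hS.compensator_ge hn hji t h ω) (gain_nonneg j i t)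
  refine le_trans ?_ hmain
  have hlh : 0 ≤ (lam : ℝ) * h := by positivity
  have : (B : ℝ) / ((n : ℝ) - 1) * h * (G.meanAge i t - G.meanMinAge t -
      ∫ ω, G.untouchedAge i t ω ∂P - lam * h * G.meanAge i t) =
      h / ((n : ℝ) - 1) * (B * (G.meanAge i t - G.meanMinAge t - ∫ ω, G.untouchedAge i t ω ∂P) -
        lam * h * (B * G.meanAge i t)) := by ring
  rw [this]
  refine mul_le_mul_of_nonneg_left ?_ hc
  have := mul_le_mul_of_nonneg_left hupp hlh
  linarith

/-- The semi-distributed scheme attains the bound up to any `ε`. -/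
theorem IsSemiDistributed.eventually_le (hn : 2 ≤ n) (hlam : 0 < lam) (hS : G.IsSemiDistributed B)
    (i : Fin n) {ε : ℝ} (hε : 0 < ε) :
    ∀ᶠ t in atTop, G.meanAge i t ≤ optimalAge n lamE lam B + ε := by
  have hG := hS.totalRateLE
  have hn' : (2 : ℝ) ≤ n := by exact_mod_cast hn
  have hl : (0 : ℝ) < lam := by exact_mod_cast hlam
  set γ := eventRateBound n lamE lam B
  set β := (B : ℝ) / ((n : ℝ) - 1) with hβdef
  have hβ : 0 ≤ β := div_nonneg B.2 (by linarith)
  have hα : 0 < (lam : ℝ) / n + β := by positivity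
  have hb : Tendsto (fun t => (lamE : ℝ) + β * (G.meanMinAge t + ∫ ω, G.untouchedAge i t ω ∂P))
      atTop (𝓝 (lamE + β * (lamE / lam))) := by
    have := (((hG.tendsto_meanMinAge hn hlam).add
      (tendsto_integral_untouchedAge (G := G) hn hlam i)).const_mul β).const_add (lamE : ℝ)
    rwa [add_zero] at this
  -- The extra `β * lam` in C absorbs the loss from deliveries during the interval.
  refine eventually_le_of_recursion (f := G.meanAge i) (C := 2 * (γ : ℝ) ^ 2 + β * lam)
    (b := fun t => (lamE : ℝ) + β * (G.meanMinAge t + ∫ ω, G.untouchedAge i t ω ∂P)) hα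
    (NNReal.coe_nonneg lamE) (meanAge_le i) hb (fun t h => ?_) hε
  have h1 := (abs_le.1 (hG.abs_meanAge_sub_le hn i t h)).2
  have h2 := hS.sum_integral_gain_ge hn i t h
  have h3 : 0 ≤ β * lam * (h : ℝ) ^ 2 := by positivity
  rw [← hβdef] at h2
  nlinarith

theorem IsSemiDistributed.hasSteadyStateMeanAge (hn : 2 ≤ n) (hlam : 0 < lam)
    (hS : G.IsSemiDistributed B) (i : Fin n) :
    G.HasSteadyStateMeanAge i (optimalAge n lamE lam B) := by
  refine Metric.tendsto_nhds.2 fun ε hε => ?_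
  filter_upwards [hS.totalRateLE.eventually_ge hn hlam i (half_pos hε),
    hS.eventually_le hn hlam i (half_pos hε)] with t h1 h2
  rw [Real.dist_eq, abs_lt]
  constructor <;> linarith

end SemiDistributed

end GossipNetwork

theorem theorem2 (n : ℕ) (hn : 2 ≤ n) (lamE lam B : ℝ≥0) (hlamE : 0 < lamE) (hlam : 0 < lam) :
    -- every policy of total rate at most `B` obeys the lower bound
    (∀ {Ω : Type*} [MeasurableSpace Ω] (P : Measure Ω) [IsProbabilityMeasure P]
      (G : GossipNetwork P n lamE lam), G.TotalRateLE B → ∀ i : Fin n,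
        (∀ t, Integrable (G.age i t) P) ∧
        ((optimalAge n lamE lam B : ℝ) : EReal) ≤
          liminf (fun t => ((G.meanAge i t : ℝ) : EReal)) atTop ∧
        ∀ a, G.HasSteadyStateMeanAge i a → optimalAge n lamE lam B ≤ a) ∧
    -- the semi-distributed scheme is such a policy and attains the bound
    (∀ {Ω : Type*} [MeasurableSpace Ω] (P : Measure Ω) [IsProbabilityMeasure P]
      (S : GossipNetwork P n lamE lam), S.IsSemiDistributed B →
        S.TotalRateLE B ∧
        ∀ i : Fin n, S.HasSteadyStateMeanAge i (optimalAge n lamE lam B)) ∧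
    -- so no policy of total rate at most `B` has a smaller steady-state mean age
    (∀ {Ω Ω' : Type*} [MeasurableSpace Ω] [MeasurableSpace Ω']
      (P : Measure Ω) [IsProbabilityMeasure P] (P' : Measure Ω') [IsProbabilityMeasure P']
      (S : GossipNetwork P n lamE lam) (G : GossipNetwork P' n lamE lam),
        S.IsSemiDistributed B → G.TotalRateLE B →
        ∀ (i k : Fin n) (a b : ℝ), S.HasSteadyStateMeanAge i a → G.HasSteadyStateMeanAge k b →
          a ≤ b) := by
  refine ⟨?_, ?_, ?_⟩
  · intro Ω _ P _ G hG i
    exact ⟨fun t => G.integrable_age i t, hG.optimalAge_le_liminf hn hlam i,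
      fun a ha => hG.optimalAge_le hn hlam i ha⟩
  · intro Ω _ P _ S hS
    exact ⟨hS.totalRateLE, fun i => hS.hasSteadyStateMeanAge hn hlam i⟩
  · intro Ω Ω' _ _ P _ P' _ S G hS hG i k a b ha hb
    rw [tendsto_nhds_unique ha (hS.hasSteadyStateMeanAge hn hlam i)]
    exact hG.optimalAge_le hn hlam k hb
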